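/- Work in the two-sorted first-order language of second-order arithmetic, with number variables, set variables, $0,1,+,\cdot,<,\in$, and equality between numbers. Let $\mathsf{RCA}_0$ be the theory consisting of the basic axioms for $0,1,+,\cdot,<$, the induction scheme for $\Sigma^0_1$ formulas, and the comprehension scheme for $\Delta^0_1$ predicates (number and set parameters allowed). Relations on $\mathbb{N}$ and functions $\mathbb{N}\to\mathbb{N}$ are represented by sets of pairs $(m,n)$, coded by the numbers $(m+n)^2+m$. A set $S\subseteq\mathbb{N}$ is infinite if for every $x$ there is $y>x$ with $y\in S$. Consider the following sentences of this language. - $\mathsf{CAC}$ (Chain-AntiChain): for every partial order $\preceq$ on $\mathbb{N}$ there is an infinite set $S\subseteq\mathbb{N}$ which either is a chain (any two elements of $S$ are $\preceq$-comparable) or is an antichain (any two distinct elements of $S$ are $\preceq$-incomparable). - $\mathsf{ADS}$ (Ascending or Descending Sequence): for every strict linear order $<_L$ on $\mathbb{N}$ there is a function $f:\mathbb{N}\to\mathbb{N}$ such that either $f(n)<_L f(m)$ for all $n<m$, or $f(m)<_L f(n)$ for all $n<m$. - $\mathsf{EM}$ (Erdős–Moser): for every tournament $T$ on $\mathbb{N}$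 (an irreflexive binary relation such that for all $x\neq y$ exactly one of $T(x,y)$, $T(y,x)$ holds) there is an infinite set $S\subseteq\mathbb{N}$ on which $T$ is transitive, i.e. for all $x,y,z\in S$, if $T(x,y)$ and $T(y,z)$ then $T(x,z)$. Then $\mathsf{CAC}$ does not prove $\mathsf{EM}$ over $\mathsf{RCA}_0$, and $\mathsf{ADS}$ does not prove $\mathsf{EM}$ over $\mathsf{RCA}_0$; that is, $\mathsf{RCA}_0+\mathsf{CAC}\nvdash\mathsf{EM}$ and $\mathsf{RCA}_0+\mathsf{ADS}\nvdash\mathsf{EM}$. -/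

import Mathlib

/-! # Second-order arithmetic: language, deductive calculus, `RCA₀`, and the principles CAC, ADS, EM -/

namespace SOA

/-- Numerical terms of the language `L₂`. Number variables are named by natural numbers. -/
inductive Tm : Type
  | var (x : ℕ) : Tm
  | zero : Tm
  | one : Tm
  | add (t u : Tm) : Tm
  | mul (t u : Tm) : Tm

/-- Formulas of the two-sorted language `L₂` of second-order arithmetic. Number variables and set
variables are two disjoint families of variables, each of them named by natural numbers. As usual,
equality is a primitive relation between numbers only. -/
inductive Fm : Type
  /-- `t = u` -/
  | eq (t u : Tm) : Fm
  /-- `t < u` -/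
  | lt (t u : Tm) : Fm
  /-- `t ∈ X` -/
  | mem (t : Tm) (X : ℕ) : Fm
  | neg (φ : Fm) : Fm
  | imp (φ ψ : Fm) : Fm
  /-- `∀ x, φ`, where `x` is a number variable -/
  | all (x : ℕ) (φ : Fm) : Fm
  /-- `∀ X, φ`, where `X` is a set variable -/
  | allS (X : ℕ) (φ : Fm) : Fm

namespace Tm

/-- The number variable `x` occurs in the term. -/
def Occurs (x : ℕ) : Tm → Prop
  | var y => x = y
  | zero => False
  | one => False
  | add t u => Occurs x t ∨ Occurs x u
  | mul t u => Occurs x t ∨ Occurs x u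

/-- `s.subst x t` is the term `s[t/x]`: the variable `x` is replaced by `t` in `s`. -/
def subst (s : Tm) (x : ℕ) (t : Tm) : Tm :=
  match s with
  | var y => if y = x then t else var y
  | zero => zero
  | one => one
  | add u v => add (u.subst x t) (v.subst x t)
  | mul u v => mul (u.subst x t) (v.subst x t)

/-- The standard pairing term `(t, u) = (t + u) * (t + u) + t`. -/
def pair (t u : Tm) : Tm := add (mul (add t u) (add t u)) t

end Tm

namespace Fm

/-! ### Defined connectives and quantifiers -/

def or (φ ψ : Fm) : Fm := imp (neg φ) ψ

def and (φ ψ : Fm) : Fm := neg (imp φ (neg ψ))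

def iff (φ ψ : Fm) : Fm := and (imp φ ψ) (imp ψ φ)

/-- `∃ x, φ`, where `x` is a number variable -/
def ex (x : ℕ) (φ : Fm) : Fm := neg (all x (neg φ))

/-- `∃ X, φ`, where `X` is a set variable -/
def exS (X : ℕ) (φ : Fm) : Fm := neg (allS X (neg φ))

/-! ### Free variables and substitution -/

/-- The number variable `x` occurs free in the formula. -/
def Free (x : ℕ) : Fm → Prop
  | eq t u => t.Occurs x ∨ u.Occurs x
  | lt t u => t.Occurs x ∨ u.Occurs x
  | mem t _ => t.Occurs x
  | neg φ => Free x φ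
  | imp φ ψ => Free x φ ∨ Free x ψ
  | all y φ => x ≠ y ∧ Free x φ
  | allS _ φ => Free x φ

/-- The set variable `X` occurs free in the formula. -/
def FreeS (X : ℕ) : Fm → Prop
  | eq _ _ => False
  | lt _ _ => False
  | mem _ Y => X = Y
  | neg φ => FreeS X φ
  | imp φ ψ => FreeS X φ ∨ FreeS X ψ
  | all _ φ => FreeS X φ
  | allS Y φ => X ≠ Y ∧ FreeS X φ

/-- `φ.subst x t` replaces the free occurrences of the number variable `x` in `φ` by `t`. -/
def subst (x : ℕ) (t : Tm) : Fm → Fm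
  | eq u v => eq (u.subst x t) (v.subst x t)
  | lt u v => lt (u.subst x t) (v.subst x t)
  | mem u Y => mem (u.subst x t) Y
  | neg φ => neg (subst x t φ)
  | imp φ ψ => imp (subst x t φ) (subst x t ψ)
  | all y φ => if y = x then all y φ else all y (subst x t φ)
  | allS Y φ => allS Y (subst x t φ)

/-- `φ.substS X Y` replaces the free occurrences of the set variable `X` in `φ` by `Y`. -/
def substS (X Y : ℕ) : Fm → Fm
  | eq u v => eq u v
  | lt u v => lt u v
  | mem u Z => mem u (if Z = X then Y else Z)
  | neg φ => neg (substS X Y φ)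
  | imp φ ψ => imp (substS X Y φ) (substS X Y ψ)
  | all y φ => all y (substS X Y φ)
  | allS Z φ => if Z = X then allS Z φ else allS Z (substS X Y φ)

/-- The term `t` is free for the number variable `x` in the formula: no variable of `t` is captured
when `t` is substituted for `x`. -/
def FreeFor (t : Tm) (x : ℕ) : Fm → Prop
  | eq _ _ => True
  | lt _ _ => True
  | mem _ _ => True
  | neg φ => FreeFor t x φ
  | imp φ ψ => FreeFor t x φ ∧ FreeFor t x ψ
  | all y φ => ¬ Free x (all y φ) ∨ (¬ t.Occurs y ∧ FreeFor t x φ)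
  | allS _ φ => FreeFor t x φ

/-- The set variable `Y` is free for the set variable `X` in the formula. -/
def FreeForS (Y X : ℕ) : Fm → Prop
  | eq _ _ => True
  | lt _ _ => True
  | mem _ _ => True
  | neg φ => FreeForS Y X φ
  | imp φ ψ => FreeForS Y X φ ∧ FreeForS Y X ψ
  | all _ φ => FreeForS Y X φ
  | allS Z φ => ¬ FreeS X (allS Z φ) ∨ (Y ≠ Z ∧ FreeForS Y X φ)

end Fm

open Fm

/-- `Derives T φ`: the formula `φ` has a formal proof from the (non-logical) axioms `T` in the usual
Hilbert-style calculus of classical two-sorted first-order logic with equality between numbers.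
Because of the generalization rules, an axiom with free variables has the same strength as its
universal closure. -/
inductive Derives (T : Set Fm) : Fm → Prop
  | ax {φ : Fm} : φ ∈ T → Derives T φ
  | mp {φ ψ : Fm} : Derives T (imp φ ψ) → Derives T φ → Derives T ψ
  | gen {φ : Fm} (x : ℕ) : Derives T φ → Derives T (all x φ)
  | genS {φ : Fm} (X : ℕ) : Derives T φ → Derives T (allS X φ)
  | prop1 (φ ψ : Fm) : Derives T (imp φ (imp ψ φ))
  | prop2 (φ ψ χ : Fm) :
      Derives T (imp (imp φ (imp ψ χ)) (imp (imp φ ψ) (imp φ χ)))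
  | prop3 (φ ψ : Fm) : Derives T (imp (imp (neg φ) (neg ψ)) (imp ψ φ))
  | inst (φ : Fm) (x : ℕ) (t : Tm) :
      FreeFor t x φ → Derives T (imp (all x φ) (φ.subst x t))
  | instS (φ : Fm) (X Y : ℕ) :
      FreeForS Y X φ → Derives T (imp (allS X φ) (φ.substS X Y))
  | dist (φ ψ : Fm) (x : ℕ) :
      ¬ Free x φ → Derives T (imp (all x (imp φ ψ)) (imp φ (all x ψ)))
  | distS (φ ψ : Fm) (X : ℕ) :
      ¬ FreeS X φ → Derives T (imp (allS X (imp φ ψ)) (imp φ (allS X ψ)))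
  | eqRefl (t : Tm) : Derives T (eq t t)
  | eqSubst (φ : Fm) (x : ℕ) (t u : Tm) : FreeFor t x φ → FreeFor u x φ →
      Derives T (imp (eq t u) (imp (φ.subst x t) (φ.subst x u)))

/-! ### The base theory `RCA₀` -/

/-- `Σ⁰₀` formulas: set quantifiers do not occur and all number quantifiers are bounded,
i.e. of the form `∀ x < t` or `∃ x < t` with a term `t` in which `x` does not occur. -/
inductive Sigma00 : Fm → Prop
  | eq (t u : Tm) : Sigma00 (eq t u)
  | lt (t u : Tm) : Sigma00 (lt t u)
  | mem (t : Tm) (X : ℕ) : Sigma00 (mem t X)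
  | neg {φ : Fm} : Sigma00 φ → Sigma00 (neg φ)
  | imp {φ ψ : Fm} : Sigma00 φ → Sigma00 ψ → Sigma00 (imp φ ψ)
  | ball {φ : Fm} (x : ℕ) (t : Tm) :
      ¬ t.Occurs x → Sigma00 φ → Sigma00 (all x (imp (lt (Tm.var x) t) φ))
  | bex {φ : Fm} (x : ℕ) (t : Tm) :
      ¬ t.Occurs x → Sigma00 φ → Sigma00 (ex x (and (lt (Tm.var x) t) φ))

/-- `Σ⁰₁` formulas `∃ x, θ` with `θ` in `Σ⁰₀` (set parameters are allowed). -/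
def Sigma01 (φ : Fm) : Prop := ∃ x θ, Sigma00 θ ∧ φ = ex x θ

/-- `Π⁰₁` formulas `∀ x, θ` with `θ` in `Σ⁰₀` (set parameters are allowed). -/
def Pi01 (φ : Fm) : Prop := ∃ x θ, Sigma00 θ ∧ φ = all x θ

/-- The basic axioms on `0, 1, +, ·, <`, with number variables `m = x₀` and `n = x₁`. -/
inductive BasicAxiom : Fm → Prop
  /-- `n + 1 ≠ 0` -/
  | succ_ne_zero : BasicAxiom (neg (eq (Tm.add (Tm.var 1) Tm.one) Tm.zero))
  /-- `m + 1 = n + 1 → m = n` -/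
  | succ_inj : BasicAxiom
      (imp (eq (Tm.add (Tm.var 0) Tm.one) (Tm.add (Tm.var 1) Tm.one)) (eq (Tm.var 0) (Tm.var 1)))
  /-- `m + 0 = m` -/
  | add_zero : BasicAxiom (eq (Tm.add (Tm.var 0) Tm.zero) (Tm.var 0))
  /-- `m + (n + 1) = (m + n) + 1` -/
  | add_succ : BasicAxiom
      (eq (Tm.add (Tm.var 0) (Tm.add (Tm.var 1) Tm.one))
        (Tm.add (Tm.add (Tm.var 0) (Tm.var 1)) Tm.one))
  /-- `m · 0 = 0` -/
  | mul_zero : BasicAxiom (eq (Tm.mul (Tm.var 0) Tm.zero) Tm.zero)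
  /-- `m · (n + 1) = (m · n) + m` -/
  | mul_succ : BasicAxiom
      (eq (Tm.mul (Tm.var 0) (Tm.add (Tm.var 1) Tm.one))
        (Tm.add (Tm.mul (Tm.var 0) (Tm.var 1)) (Tm.var 0)))
  /-- `¬ m < 0` -/
  | not_lt_zero : BasicAxiom (neg (lt (Tm.var 0) Tm.zero))
  /-- `m < n + 1 ↔ (m < n ∨ m = n)` -/
  | lt_succ : BasicAxiom
      (iff (lt (Tm.var 0) (Tm.add (Tm.var 1) Tm.one))
        (or (lt (Tm.var 0) (Tm.var 1)) (eq (Tm.var 0) (Tm.var 1))))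

/-- The axioms of `RCA₀`: the basic axioms, `Σ⁰₁` induction and `Δ⁰₁` comprehension. The formulas
in the two schemes may have further free number and set variables as parameters. -/
inductive RCA0 : Fm → Prop
  | basic {φ : Fm} : BasicAxiom φ → RCA0 φ
  /-- `(φ(0) ∧ ∀ n (φ(n) → φ(n + 1))) → ∀ n φ(n)` -/
  | induction (φ : Fm) (n : ℕ) : Sigma01 φ →
      RCA0 (imp
        (and (φ.subst n Tm.zero) (all n (imp φ (φ.subst n (Tm.add (Tm.var n) Tm.one)))))
        (all n φ))
  /-- `∀ n (φ(n) ↔ ψ(n)) → ∃ X ∀ n (n ∈ X ↔ φ(n))`, where `X` is not free in `φ` -/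
  | comprehension (φ ψ : Fm) (n X : ℕ) : Sigma01 φ → Pi01 ψ → ¬ FreeS X φ →
      RCA0 (imp (all n (iff φ ψ)) (exS X (all n (iff (mem (Tm.var n) X) φ))))

/-- `A` proves `B` over the base theory `RCA₀`. -/
def Proves (A B : Fm) : Prop := Derives ({φ | RCA0 φ} ∪ {A}) B

/-! ### The principles

In the formulas below, numerals that name number variables play the role of `x, y, z, …`. Binary
relations on (and functions from) the numbers are sets of coded pairs. -/

/-- `x ∈ X`, for a number variable `x` and a set variable `X` -/
def inn (x X : ℕ) : Fm := mem (Tm.var x) X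

/-- `(x, y) ∈ R`, for number variables `x`, `y` and a set variable `R` -/
def rel (R x y : ℕ) : Fm := mem (Tm.pair (Tm.var x) (Tm.var y)) R

/-- `x = y` for number variables -/
def eqv (x y : ℕ) : Fm := eq (Tm.var x) (Tm.var y)

/-- `x < y` for number variables -/
def ltv (x y : ℕ) : Fm := lt (Tm.var x) (Tm.var y)

/-- `S` is infinite: `∀ x ∃ y (x < y ∧ y ∈ S)`. -/
def infinite (S : ℕ) : Fm := all 0 (ex 1 ((ltv 0 1).and (inn 1 S)))

/-- `P` is a partial order `⪯` on the numbers: reflexive, antisymmetric and transitive. -/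
def partialOrder (P : ℕ) : Fm :=
  (all 0 (rel P 0 0)).and
  ((all 0 (all 1 (((rel P 0 1).and (rel P 1 0)).imp (eqv 0 1)))).and
  (all 0 (all 1 (all 2 (((rel P 0 1).and (rel P 1 2)).imp (rel P 0 2))))))

/-- Any two elements of `S` are comparable in `P`. -/
def chain (P S : ℕ) : Fm :=
  all 0 (all 1 (((inn 0 S).and (inn 1 S)).imp ((rel P 0 1).or (rel P 1 0))))

/-- Any two distinct elements of `S` are incomparable in `P`. -/
def antichain (P S : ℕ) : Fm :=
  all 0 (all 1 (((inn 0 S).and ((inn 1 S).and (eqv 0 1).neg)).imp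
    ((rel P 0 1).neg.and (rel P 1 0).neg)))

/-- Chain-AntiChain: every partial order on the numbers has an infinite chain or an infinite
antichain. -/
def CAC : Fm :=
  allS 0 ((partialOrder 0).imp
    (exS 1 ((infinite 1).and ((chain 0 1).or (antichain 0 1)))))

/-- `L` is a strict linear order `<_L` on the numbers: irreflexive, transitive and total. -/
def linearOrder (L : ℕ) : Fm :=
  (all 0 (rel L 0 0).neg).and
  ((all 0 (all 1 (all 2 (((rel L 0 1).and (rel L 1 2)).imp (rel L 0 2))))).and
  (all 0 (all 1 ((rel L 0 1).or ((eqv 0 1).or (rel L 1 0))))))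

/-- `F` is (the graph of) a function from numbers to numbers. -/
def function (F : ℕ) : Fm :=
  (all 0 (ex 1 (rel F 0 1))).and
  (all 0 (all 1 (all 2 (((rel F 0 1).and (rel F 0 2)).imp (eqv 1 2)))))

/-- For all `n < m`, `F(n) <_L F(m)`. -/
def ascending (L F : ℕ) : Fm :=
  all 0 (all 1 (all 2 (all 3
    (((ltv 0 1).and ((rel F 0 2).and (rel F 1 3))).imp (rel L 2 3)))))

/-- For all `n < m`, `F(m) <_L F(n)`. -/
def descending (L F : ℕ) : Fm :=
  all 0 (all 1 (all 2 (all 3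
    (((ltv 0 1).and ((rel F 0 2).and (rel F 1 3))).imp (rel L 3 2)))))

/-- Ascending or Descending Sequence: every linear order on the numbers has an infinite ascending
sequence or an infinite descending sequence. -/
def ADS : Fm :=
  allS 0 ((linearOrder 0).imp
    (exS 1 ((function 1).and ((ascending 0 1).or (descending 0 1)))))

/-- `T` is a tournament on the numbers: irreflexive, and for all `x ≠ y` exactly one of `T(x, y)`
and `T(y, x)` holds. -/
def tournament (T : ℕ) : Fm :=
  (all 0 (rel T 0 0).neg).and
  (all 0 (all 1 ((eqv 0 1).neg.imp ((rel T 0 1).iff (rel T 1 0).neg))))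

/-- `T` restricted to `S` is transitive. -/
def transitiveOn (T S : ℕ) : Fm :=
  all 0 (all 1 (all 2 (((inn 0 S).and ((inn 1 S).and (inn 2 S))).imp
    (((rel T 0 1).and (rel T 1 2)).imp (rel T 0 2)))))

/-- Erdős–Moser: every tournament on the numbers has an infinite transitive subtournament. -/
def EM : Fm :=
  allS 0 ((tournament 0).imp (exS 1 ((infinite 1).and (transitiveOn 0 1))))

end SOA

/-! By soundness it is enough to find an ω-model of `RCA0` and `CAC` (respectively `ADS`) in which
`EM` fails. Turing degrees are replaced by countable classes `𝒮` of sets that play the role of the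
semidecidable ones: they are closed under a fixed countable stock of Scott continuous operations,
and the model consists of `dec 𝒮`. Adding an oracle `f` replaces `𝒮` by `adjoin 𝒮 f`; closure
survives because `star` lifts each operation to enumeration operators (`out_star`).

The bad tournament is generic. Its code `f` also lists, point by point, a partial function from
numbers `e` to finite sets `D_e`. Once a `D_e` with at least `2 * e + 2` elements has been listed,
every later point beyond `D_e` forms a 3-cycle with two elements of `D_e`; the growing size lets one
new point serve all listed sets at once (`exists_row`). Genericity makes the graph `d` of the
partial function meet every total relation of the class, which is `Fair`. If `H` in `𝒮` is infinite,
the relation "`v` codes a subset of `H` with `2 * e + 2` elements" is total, so it meets `d`, and a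
late point of `H` closes a cycle inside `H`. Thus fairness excludes infinite transitive sets
(`Stage.not_transitive`).

It remains to add solutions of `CAC` and `ADS` while preserving fairness. Both reduce to making a
transitive relation contained in `<` homogeneous (`exists_fair_homogeneous`), by forcing with a
finite chain and an infinite reservoir in `𝒮`. Transitivity makes the ability to continue a chain
depend on its last element only, so the question whether an operator can be made to meet `d` becomes
a question about one set of `𝒮`. If that set is finite, fairness of the old class forces the
operator to be non-total (`Cond.exists_decides`). Iterating over all instances gives the two models.
-/

namespace SOA

open Function

/-! ### Semantics in ω-models -/

/-- The value of a term under an assignment of the number variables. -/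
def Tm.val (e : ℕ → ℕ) : Tm → ℕ
  | var x => e x
  | zero => 0
  | one => 1
  | add t u => t.val e + u.val e
  | mul t u => t.val e * u.val e

/-- Satisfaction in the ω-model whose sets are the members of `M`. -/
def Sat (M : Set (Set ℕ)) (e : ℕ → ℕ) (s : ℕ → Set ℕ) : Fm → Prop
  | .eq t u => t.val e = u.val e
  | .lt t u => t.val e < u.val e
  | .mem t X => t.val e ∈ s X
  | .neg φ => ¬ Sat M e s φ
  | .imp φ ψ => Sat M e s φ → Sat M e s ψ
  | .all x φ => ∀ a, Sat M (update e x a) s φ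
  | .allS X φ => ∀ Y ∈ M, Sat M e (update s X Y) φ

section sat
variable {M : Set (Set ℕ)} {e : ℕ → ℕ} {s : ℕ → Set ℕ}

@[simp] theorem sat_or {φ ψ : Fm} : Sat M e s (φ.or ψ) ↔ Sat M e s φ ∨ Sat M e s ψ := by
  simp only [Fm.or, Sat]; tauto

@[simp] theorem sat_and {φ ψ : Fm} : Sat M e s (φ.and ψ) ↔ Sat M e s φ ∧ Sat M e s ψ := by
  simp only [Fm.and, Sat]; tauto

@[simp] theorem sat_iff {φ ψ : Fm} : Sat M e s (φ.iff ψ) ↔ (Sat M e s φ ↔ Sat M e s ψ) := by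
  simp only [Fm.iff, sat_and, Sat]; tauto

@[simp] theorem sat_ex {x : ℕ} {φ : Fm} :
    Sat M e s (φ.ex x) ↔ ∃ a, Sat M (update e x a) s φ := by
  simp [Fm.ex, Sat]

@[simp] theorem sat_exS {X : ℕ} {φ : Fm} :
    Sat M e s (φ.exS X) ↔ ∃ Y ∈ M, Sat M e (update s X Y) φ := by
  simp [Fm.exS, Sat]

end sat

/-! ### Coincidence and substitution lemmas, and soundness. -/

theorem Tm.val_congr {e e' : ℕ → ℕ} {t : Tm} (h : ∀ x, t.Occurs x → e x = e' x) :
    t.val e = t.val e' := by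
  induction t with
  | var x => exact h x rfl
  | zero => rfl
  | one => rfl
  | add t u iht ihu =>
    simp only [val]; rw [iht fun x hx => h x (Or.inl hx), ihu fun x hx => h x (Or.inr hx)]
  | mul t u iht ihu =>
    simp only [val]; rw [iht fun x hx => h x (Or.inl hx), ihu fun x hx => h x (Or.inr hx)]

theorem Tm.val_update {e : ℕ → ℕ} {t : Tm} {x a : ℕ} (h : ¬ t.Occurs x) :
    t.val (update e x a) = t.val e := by
  refine val_congr fun y hy => ?_
  rw [update_of_ne]; rintro rfl; exact h hy

theorem Tm.val_subst {e : ℕ → ℕ} {x : ℕ} {s t : Tm} :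
    (s.subst x t).val e = s.val (update e x (t.val e)) := by
  induction s with
  | var y =>
    by_cases hy : y = x
    · subst hy; simp [subst, val]
    · simp [subst, val, hy]
  | zero => rfl
  | one => rfl
  | add t u iht ihu => simp only [subst, val, iht, ihu]
  | mul t u iht ihu => simp only [subst, val, iht, ihu]

theorem sat_congr {M : Set (Set ℕ)} {e e' : ℕ → ℕ} {s s' : ℕ → Set ℕ} {φ : Fm}
    (he : ∀ x, Fm.Free x φ → e x = e' x) (hs : ∀ X, Fm.FreeS X φ → s X = s' X) :
    Sat M e s φ ↔ Sat M e' s' φ := by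
  induction φ generalizing e e' s s' with
  | eq t u =>
    simp only [Sat]
    rw [Tm.val_congr fun x hx => he x (Or.inl hx), Tm.val_congr fun x hx => he x (Or.inr hx)]
  | lt t u =>
    simp only [Sat]
    rw [Tm.val_congr fun x hx => he x (Or.inl hx), Tm.val_congr fun x hx => he x (Or.inr hx)]
  | mem t X => simp only [Sat]; rw [Tm.val_congr fun x hx => he x hx, hs X rfl]
  | neg φ ih => simp only [Sat]; rw [ih he hs]
  | imp φ ψ ihφ ihψ =>
    simp only [Sat]
    rw [ihφ (fun x hx => he x (Or.inl hx)) (fun x hx => hs x (Or.inl hx)),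
      ihψ (fun x hx => he x (Or.inr hx)) (fun x hx => hs x (Or.inr hx))]
  | all y φ ih =>
    simp only [Sat]
    refine forall_congr' fun a => ih (fun x hx => ?_) hs
    by_cases h : x = y
    · subst h; simp
    · simp [h, he x ⟨h, hx⟩]
  | allS Y φ ih =>
    simp only [Sat]
    refine forall_congr' fun a => imp_congr_right fun _ => ih he (fun x hx => ?_)
    by_cases h : x = Y
    · subst h; simp
    · simp [h, hs x ⟨h, hx⟩]

theorem sat_update {M : Set (Set ℕ)} {e : ℕ → ℕ} {s : ℕ → Set ℕ} {φ : Fm} {x a : ℕ}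
    (h : ¬ Fm.Free x φ) : Sat M (update e x a) s φ ↔ Sat M e s φ := by
  refine sat_congr (fun y hy => ?_) fun _ _ => rfl
  rw [update_of_ne]; rintro rfl; exact h hy

theorem sat_updateS {M : Set (Set ℕ)} {e : ℕ → ℕ} {s : ℕ → Set ℕ} {φ : Fm} {X : ℕ} {Y : Set ℕ}
    (h : ¬ Fm.FreeS X φ) : Sat M e (update s X Y) φ ↔ Sat M e s φ := by
  refine sat_congr (fun _ _ => rfl) fun y hy => ?_
  rw [update_of_ne]; rintro rfl; exact h hy

theorem Tm.subst_of_not_occurs {s t : Tm} {x : ℕ} (h : ¬ s.Occurs x) : s.subst x t = s := by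
  induction s with
  | var y => simp only [Occurs] at h; simp [subst, Ne.symm h]
  | zero => rfl
  | one => rfl
  | add t u iht ihu => simp only [Occurs, not_or] at h; simp [subst, iht h.1, ihu h.2]
  | mul t u iht ihu => simp only [Occurs, not_or] at h; simp [subst, iht h.1, ihu h.2]

theorem Fm.subst_of_not_free {φ : Fm} {t : Tm} {x : ℕ} (h : ¬ Free x φ) : φ.subst x t = φ := by
  induction φ with
  | eq u v =>
    simp only [Free, not_or] at h
    simp [subst, Tm.subst_of_not_occurs h.1, Tm.subst_of_not_occurs h.2]
  | lt u v =>
    simp only [Free, not_or] at h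
    simp [subst, Tm.subst_of_not_occurs h.1, Tm.subst_of_not_occurs h.2]
  | mem u X => simp only [Free] at h; simp [subst, Tm.subst_of_not_occurs h]
  | neg φ ih => simp only [Free] at h; simp [subst, ih h]
  | imp φ ψ ihφ ihψ => simp only [Free, not_or] at h; simp [subst, ihφ h.1, ihψ h.2]
  | all y φ ih =>
    simp only [Free, not_and] at h
    by_cases hy : y = x
    · simp [subst, hy]
    · simp [subst, hy, ih (h (Ne.symm hy))]
  | allS Y φ ih => simp only [Free] at h; simp [subst, ih h]

theorem Fm.substS_of_not_free {φ : Fm} {X Y : ℕ} (h : ¬ FreeS X φ) : φ.substS X Y = φ := by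
  induction φ with
  | eq u v => rfl
  | lt u v => rfl
  | mem u Z => simp only [FreeS] at h; simp [substS, Ne.symm h]
  | neg φ ih => simp only [FreeS] at h; simp [substS, ih h]
  | imp φ ψ ihφ ihψ => simp only [FreeS, not_or] at h; simp [substS, ihφ h.1, ihψ h.2]
  | all y φ ih => simp only [FreeS] at h; simp [substS, ih h]
  | allS Z φ ih =>
    simp only [FreeS, not_and] at h
    by_cases hy : Z = X
    · simp [substS, hy]
    · simp [substS, hy, ih (h (Ne.symm hy))]

theorem sat_subst {M : Set (Set ℕ)} {e : ℕ → ℕ} {s : ℕ → Set ℕ} {φ : Fm} {x : ℕ} {t : Tm}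
    (h : Fm.FreeFor t x φ) : Sat M e s (φ.subst x t) ↔ Sat M (update e x (t.val e)) s φ := by
  induction φ generalizing e s with
  | eq u v => simp only [Fm.subst, Sat, Tm.val_subst]
  | lt u v => simp only [Fm.subst, Sat, Tm.val_subst]
  | mem u X => simp only [Fm.subst, Sat, Tm.val_subst]
  | neg φ ih => simp only [Fm.subst, Sat]; rw [ih h]
  | imp φ ψ ihφ ihψ => simp only [Fm.subst, Sat]; rw [ihφ h.1, ihψ h.2]
  | all y φ ih =>
    rcases h with h | ⟨hy, h⟩
    · rw [Fm.subst_of_not_free h, sat_update h]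
    · by_cases hyx : y = x
      · subst hyx; simp [Fm.subst, Sat]
      · simp only [Fm.subst, hyx, if_false, Sat]
        refine forall_congr' fun a => ?_
        rw [ih h, Tm.val_update hy, update_comm hyx]
  | allS Y φ ih => simp only [Fm.subst, Sat]; exact forall₂_congr fun _ _ => ih h

theorem sat_substS {M : Set (Set ℕ)} {e : ℕ → ℕ} {s : ℕ → Set ℕ} {φ : Fm} {X Y : ℕ}
    (h : Fm.FreeForS Y X φ) : Sat M e s (φ.substS X Y) ↔ Sat M e (update s X (s Y)) φ := by
  induction φ generalizing e s with
  | eq u v => rfl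
  | lt u v => rfl
  | mem u Z =>
    by_cases hZ : Z = X
    · subst hZ; simp [Fm.substS, Sat]
    · simp [Fm.substS, Sat, hZ]
  | neg φ ih => simp only [Fm.substS, Sat]; rw [ih h]
  | imp φ ψ ihφ ihψ => simp only [Fm.substS, Sat]; rw [ihφ h.1, ihψ h.2]
  | all y φ ih => simp only [Fm.substS, Sat]; exact forall_congr' fun _ => ih h
  | allS Z φ ih =>
    rcases h with h | ⟨hY, h⟩
    · rw [Fm.substS_of_not_free h, sat_updateS h]
    · by_cases hZ : Z = X
      · subst hZ; simp [Fm.substS, Sat]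
      · simp only [Fm.substS, hZ, if_false, Sat]
        refine forall₂_congr fun a _ => ?_
        rw [ih h, update_of_ne hY, update_comm hZ]

/-- Validity in the ω-model `M`, under the finitely supported assignments of numbers. -/
def Valid (M : Set (Set ℕ)) (φ : Fm) : Prop :=
  ∀ (e : ℕ →₀ ℕ) (s : ℕ → Set ℕ), (∀ X, s X ∈ M) → Sat M e s φ

/-- Generalization changes an assignment at one variable only, so soundness survives the restriction
to finitely supported assignments. These are countable, which later allows definable sets to be
treated as sets of codes of assignments. -/
theorem Derives.valid {M : Set (Set ℕ)} {T : Set Fm} {φ : Fm} (h : Derives T φ)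
    (hT : ∀ ψ ∈ T, Valid M ψ) : Valid M φ := by
  induction h with
  | ax h => exact hT _ h
  | mp _ _ ih₁ ih₂ => exact fun e s hs => ih₁ e s hs (ih₂ e s hs)
  | gen x _ ih =>
    intro e s hs a
    have := ih (e.update x a) s hs
    rwa [Finsupp.coe_update] at this
  | genS X _ ih =>
    intro e s hs Y hY
    refine ih e _ fun Z => ?_
    by_cases hZ : Z = X
    · subst hZ; simpa using hY
    · simpa [hZ] using hs Z
  | prop1 φ ψ => exact fun e s hs h _ => h
  | prop2 φ ψ χ => exact fun e s hs h₁ h₂ h₃ => h₁ h₃ (h₂ h₃)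
  | prop3 φ ψ => exact fun e s hs h₁ h₂ => by_contra fun h₃ => h₁ h₃ h₂
  | inst φ x t h => exact fun e s hs h₁ => (sat_subst h).2 (h₁ _)
  | instS φ X Y h => exact fun e s hs h₁ => (sat_substS h).2 (h₁ _ (hs Y))
  | dist φ ψ x h => exact fun e s hs h₁ h₂ a => h₁ a ((sat_update h).2 h₂)
  | distS φ ψ X h => exact fun e s hs h₁ h₂ Y hY => h₁ Y hY ((sat_updateS h).2 h₂)
  | eqRefl t => exact fun e s hs => rfl
  | eqSubst φ x t u ht hu =>
    intro e s hs h h₁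
    rw [sat_subst hu]; rw [sat_subst ht] at h₁
    simp only [Sat] at h
    rwa [← h]

/-! ### Continuous operations and classes of sets closed under them -/

/-- Scott continuity, for increasing sequences, of a predicate on a complete lattice. -/
structure SC {L : Type*} [CompleteLattice L] (p : L → Prop) : Prop where
  mono : ∀ ⦃S S' : L⦄, S ≤ S' → p S → p S'
  cont : ∀ S : ℕ → L, Monotone S → p (⨆ k, S k) → ∃ k, p (S k)

namespace SC
variable {L : Type*} [CompleteLattice L] {p q : L → Prop}

theorem const (c : Prop) : SC fun _ : L => c := ⟨fun _ _ _ h => h, fun _ _ h => ⟨0, h⟩⟩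

theorem and (hp : SC p) (hq : SC q) : SC fun S => p S ∧ q S := by
  refine ⟨fun S S' h hS => ⟨hp.mono h hS.1, hq.mono h hS.2⟩, fun S hS h => ?_⟩
  obtain ⟨k, hk⟩ := hp.cont S hS h.1
  obtain ⟨l, hl⟩ := hq.cont S hS h.2
  exact ⟨max k l, hp.mono (hS (le_max_left _ _)) hk, hq.mono (hS (le_max_right _ _)) hl⟩

theorem or (hp : SC p) (hq : SC q) : SC fun S => p S ∨ q S := by
  refine ⟨fun S S' h hS => hS.imp (hp.mono h) (hq.mono h), fun S hS h => ?_⟩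
  rcases h with h | h
  · exact (hp.cont S hS h).imp fun _ => Or.inl
  · exact (hq.cont S hS h).imp fun _ => Or.inr

theorem exists' {ι : Sort*} {p : ι → L → Prop} (hp : ∀ i, SC (p i)) : SC fun S => ∃ i, p i S := by
  refine ⟨fun S S' h ⟨i, hi⟩ => ⟨i, (hp i).mono h hi⟩, fun S hS ⟨i, hi⟩ => ?_⟩
  exact ((hp i).cont S hS hi).imp fun _ h => ⟨i, h⟩

/-- Each of the finitely many conditions holds at some stage of the sequence; by monotonicity all
hold at any common upper bound. -/
theorem ball {ι : Type*} {p : ι → L → Prop} (F : Set ι) (hF : F.Finite) (hp : ∀ i, SC (p i)) :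
    SC fun S => ∀ i ∈ F, p i S := by
  refine ⟨fun S S' h hi i hiF => (hp i).mono h (hi i hiF), fun S hS h => ?_⟩
  choose! k hk using fun i hi => (hp i).cont S hS (h i hi)
  obtain ⟨N, hN⟩ := (hF.image k).bddAbove
  exact ⟨N, fun i hi => (hp i).mono (hS (hN ⟨i, hi, rfl⟩)) (hk i hi)⟩

theorem ball_list {ι : Type*} {p : ι → L → Prop} (F : List ι) (hp : ∀ i, SC (p i)) :
    SC fun S => ∀ i ∈ F, p i S :=
  ball {i | i ∈ F} (List.finite_toSet F) hp

theorem ball_finset {ι : Type*} {p : ι → L → Prop} (F : Finset ι) (hp : ∀ i, SC (p i)) :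
    SC fun S => ∀ i ∈ F, p i S := by
  simpa only [Finset.mem_coe] using ball (F : Set ι) F.finite_toSet hp

theorem ball_lt {p : ℕ → L → Prop} (n : ℕ) (hp : ∀ i, SC (p i)) :
    SC fun S => ∀ i < n, p i S :=
  ball {i | i < n} (Set.finite_lt_nat n) hp

theorem pairwise {R : ℕ → ℕ → L → Prop} (l : List ℕ) (hR : ∀ a b, SC (R a b)) :
    SC fun S => l.Pairwise fun a b => R a b S := by
  induction l with
  | nil => simpa using const True
  | cons a l ih => simpa only [List.pairwise_cons] using (ball_list l (hR a)).and ih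

theorem mem {ι : Type*} (i : ι) (n : ℕ) : SC fun S : ι → Set ℕ => n ∈ S i := by
  refine ⟨fun S S' h hS => h i hS, fun S hS h => ?_⟩
  simpa [iSup_apply] using h

end SC

/-! ### Enumeration operators and relativization to an oracle. -/

/-- Operations on sets of numbers with four arguments. -/
abbrev Op := (Fin 4 → Set ℕ) → Set ℕ

/-- The operation is Scott continuous. -/
def Op.Cont (Ψ : Op) : Prop := ∀ n, SC fun S => n ∈ Ψ S

/-- The code of a pair consisting of a finite sequence and a number. -/
def pr (σ : List ℕ) (n : ℕ) : ℕ := Nat.pair (Encodable.encode σ) n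

/-- The finite sequence coded in a number. -/
def seqOf (m : ℕ) : List ℕ := Denumerable.ofNat (List ℕ) m.unpair.1

@[simp] theorem seqOf_pr (σ : List ℕ) (n : ℕ) : seqOf (pr σ n) = σ := by simp [seqOf, pr]

@[simp] theorem unpair_pr (σ : List ℕ) (n : ℕ) : (pr σ n).unpair.2 = n := by simp [pr]

/-- The numbers that the enumeration operator `A` lists on seeing the finite sequence `σ`. -/
def outAt (A : Set ℕ) (σ : List ℕ) : Set ℕ := {n | ∃ τ, τ <+: σ ∧ pr τ n ∈ A}

theorem outAt_mono {A : Set ℕ} {σ τ : List ℕ} (h : σ <+: τ) : outAt A σ ⊆ outAt A τ :=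
  fun _ ⟨ρ, hρ, hn⟩ => ⟨ρ, hρ.trans h, hn⟩

theorem SC.mem_outAt (i : Fin 4) (σ : List ℕ) (n : ℕ) :
    SC fun S : Fin 4 → Set ℕ => n ∈ outAt (S i) σ :=
  SC.exists' fun τ => (SC.const (τ <+: σ)).and (SC.mem i _)

/-- The first `k` values of `f`. -/
def res (f : ℕ → ℕ) (k : ℕ) : List ℕ := (List.range k).map f

@[simp] theorem length_res (f : ℕ → ℕ) (k : ℕ) : (res f k).length = k := by simp [res]

theorem res_prefix (f : ℕ → ℕ) {k l : ℕ} (h : k ≤ l) : res f k <+: res f l := by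
  obtain ⟨d, rfl⟩ := Nat.exists_eq_add_of_le h
  simp [res, List.range_add]

theorem prefix_res {f : ℕ → ℕ} {k : ℕ} {σ : List ℕ} (h : σ <+: res f k) :
    σ = res f σ.length := by
  have hl : σ.length ≤ k := by simpa using h.length_le
  exact (List.prefix_of_prefix_length_le h (res_prefix f hl) (by simp)).eq_of_length (by simp)

@[simp] theorem mem_res {f : ℕ → ℕ} {k n : ℕ} : n ∈ res f k ↔ ∃ i < k, f i = n := by
  simp [res]

@[simp] theorem getElem_res {f : ℕ → ℕ} {k i : ℕ} (h : i < (res f k).length) :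
    (res f k)[i] = f i := by
  simp [res]

/-- The set listed by the enumeration operator `A` with oracle `f`. -/
def out (A : Set ℕ) (f : ℕ → ℕ) : Set ℕ := {n | ∃ k, pr (res f k) n ∈ A}

theorem mem_out {A : Set ℕ} {f : ℕ → ℕ} {n : ℕ} : n ∈ out A f ↔ ∃ k, n ∈ outAt A (res f k) := by
  constructor
  · rintro ⟨k, hk⟩
    exact ⟨k, _, List.prefix_rfl, hk⟩
  · rintro ⟨k, τ, hτ, hn⟩
    exact ⟨τ.length, by rwa [← prefix_res hτ]⟩

/-- The operation on enumeration operators induced by an operation on sets. -/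
def star (Ψ : Op) : Op := fun S => {m | m.unpair.2 ∈ Ψ fun i => outAt (S i) (seqOf m)}

theorem star_cont {Ψ : Op} (h : Ψ.Cont) : (star Ψ).Cont := by
  refine fun n => ⟨fun S S' hS hn => ?_, fun S hS hn => ?_⟩
  · refine (h _).mono (fun i m => ?_) hn
    rintro ⟨τ, hτ, hm⟩
    exact ⟨τ, hτ, hS i hm⟩
  · refine (h n.unpair.2).cont (fun k i => outAt (S k i) (seqOf n)) ?_ ?_
    · rintro k l hkl i m ⟨τ, hτ, hm⟩
      exact ⟨τ, hτ, hS hkl i hm⟩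
    · refine (h _).mono (fun i m => ?_) hn
      rintro ⟨τ, hτ, hm⟩
      simp only [iSup_apply, Set.iSup_eq_iUnion, Set.mem_iUnion] at hm ⊢
      exact hm.imp fun k hk => ⟨τ, hτ, hk⟩

/-- The lifted operator runs `Ψ` on what the operators have listed from a finite part of the oracle.
By continuity, each member of the value of `Ψ` is already secured by such a finite part. -/
theorem out_star {Ψ : Op} (h : Ψ.Cont) (S : Fin 4 → Set ℕ) (f : ℕ → ℕ) :
    out (star Ψ S) f = Ψ fun i => out (S i) f := by
  ext n
  constructor
  · rintro ⟨k, hk⟩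
    simp only [star, Set.mem_ofPred_eq, unpair_pr, seqOf_pr] at hk
    exact (h n).mono (fun i m hm => mem_out.2 ⟨k, hm⟩) hk
  · intro hn
    obtain ⟨k, hk⟩ := (h n).cont (fun k i => outAt (S i) (res f k))
      (fun k l hkl i => outAt_mono (res_prefix f hkl)) ((h n).mono (fun i m hm => by
        simpa [iSup_apply] using mem_out.1 hm) hn)
    exact ⟨k, by simpa [star] using hk⟩

/-- The closure of a family of operations under `star`. -/
def Ops (B : Set Op) : Set Op := {Ψ | ∃ k : ℕ, ∃ Φ ∈ B, Ψ = star^[k] Φ}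

theorem subset_Ops {B : Set Op} : B ⊆ Ops B := fun Φ h => ⟨0, Φ, h, rfl⟩

theorem star_mem_Ops {B : Set Op} {Ψ : Op} (h : Ψ ∈ Ops B) : star Ψ ∈ Ops B := by
  obtain ⟨k, Φ, hΦ, rfl⟩ := h
  exact ⟨k + 1, Φ, hΦ, (Function.iterate_succ_apply' _ _ _).symm⟩

theorem Ops_cont {B : Set Op} (hB : ∀ Ψ ∈ B, Ψ.Cont) {Ψ : Op} (h : Ψ ∈ Ops B) : Ψ.Cont := by
  obtain ⟨k, Φ, hΦ, rfl⟩ := h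
  induction k with
  | zero => exact hB Φ hΦ
  | succ k ih => rw [Function.iterate_succ_apply']; exact star_cont ih

theorem Ops_countable {B : Set Op} (hB : B.Countable) : (Ops B).Countable := by
  have : Ops B = ⋃ k : ℕ, star^[k] '' B := by
    ext Ψ; simp [Ops, eq_comm]
  rw [this]
  exact Set.countable_iUnion fun k => hB.image _

/-- A class of sets, thought of as the semidecidable ones, closed under the operations generated
by `B`. -/
structure Closed (B : Set Op) (𝒮 : Set (Set ℕ)) : Prop where
  empty : ∅ ∈ 𝒮
  op : ∀ Ψ ∈ Ops B, ∀ S : Fin 4 → Set ℕ, (∀ i, S i ∈ 𝒮) → Ψ S ∈ 𝒮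

theorem Closed.base {B : Set Op} {𝒮 : Set (Set ℕ)} (h : Closed B 𝒮) {Ψ : Op} (hΨ : Ψ ∈ B)
    {a b c d : Set ℕ} (ha : a ∈ 𝒮) (hb : b ∈ 𝒮) (hc : c ∈ 𝒮) (hd : d ∈ 𝒮) :
    Ψ ![a, b, c, d] ∈ 𝒮 := by
  refine h.op Ψ (subset_Ops hΨ) _ fun i => ?_
  fin_cases i <;> assumption

theorem Closed.iUnion {B : Set Op} {𝒮 : ℕ → Set (Set ℕ)} (h : ∀ k, Closed B (𝒮 k))
    (hm : Monotone 𝒮) : Closed B (⋃ k, 𝒮 k) := by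
  refine ⟨Set.mem_iUnion.2 ⟨0, (h 0).empty⟩, fun Ψ hΨ S hS => ?_⟩
  choose k hk using fun i => Set.mem_iUnion.1 (hS i)
  exact Set.mem_iUnion.2 ⟨Finset.univ.sup k,
    (h _).op Ψ hΨ S fun i => hm (Finset.le_sup (Finset.mem_univ i)) (hk i)⟩

/-- Countably many operations of finite arity generate a countable class from `∅` in ω rounds. -/
theorem exists_closed {B : Set Op} (hB : B.Countable) :
    ∃ 𝒮 : Set (Set ℕ), 𝒮.Countable ∧ Closed B 𝒮 := by
  let step : Set (Set ℕ) → Set (Set ℕ) := fun 𝒞 =>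
    𝒞 ∪ Set.image2 (fun Ψ S => Ψ S) (Ops B) {S : Fin 4 → Set ℕ | ∀ i, S i ∈ 𝒞}
  let C : ℕ → Set (Set ℕ) := fun k => step^[k] {∅}
  have hC : ∀ k, C (k + 1) = step (C k) := fun k => Function.iterate_succ_apply' _ _ _
  have hm : Monotone C := monotone_nat_of_le_succ fun k => by
    rw [hC]; exact Set.subset_union_left
  refine ⟨⋃ k, C k, Set.countable_iUnion fun k => ?_, Set.mem_iUnion.2 ⟨0, rfl⟩,
    fun Ψ hΨ S hS => ?_⟩
  · induction k with
    | zero => exact Set.countable_singleton _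
    | succ k ih =>
      rw [hC]
      refine ih.union ((Ops_countable hB).image2 ?_ _)
      have := Set.countable_univ_pi (fun _ : Fin 4 => ih)
      simpa [Set.pi] using this
  · choose k hk using fun i => Set.mem_iUnion.1 (hS i)
    refine Set.mem_iUnion.2 ⟨Finset.univ.sup k + 1, ?_⟩
    rw [hC]
    exact Or.inr ⟨Ψ, hΨ, S, fun i => hm (Finset.le_sup (Finset.mem_univ i)) (hk i), rfl⟩

/-- The sets that are semidecidable, relative to `𝒮`, with oracle `f`. -/
def adjoin (𝒮 : Set (Set ℕ)) (f : ℕ → ℕ) : Set (Set ℕ) := (fun A => out A f) '' 𝒮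

/-- An operation applied to sets enumerated from `f` is enumerated from `f` by its `star`. This is
why `Closed` asks for closure under all iterates of `star`, not just under `B`. -/
theorem Closed.adjoin {B : Set Op} (hB : ∀ Ψ ∈ B, Ψ.Cont) {𝒮 : Set (Set ℕ)} (h : Closed B 𝒮)
    (f : ℕ → ℕ) : Closed B (adjoin 𝒮 f) := by
  refine ⟨⟨∅, h.empty, by simp [out]⟩, fun Ψ hΨ S hS => ?_⟩
  choose A hA hAS using hS
  refine ⟨star Ψ A, h.op _ (star_mem_Ops hΨ) A hA, ?_⟩
  simp only [out_star (Ops_cont hB hΨ)]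
  congr 1
  exact funext hAS

/-- The sets that are decidable relative to `𝒮`. -/
def dec (𝒮 : Set (Set ℕ)) : Set (Set ℕ) := {Y | Y ∈ 𝒮 ∧ Yᶜ ∈ 𝒮}

/-- Preimages under `f`, restricted to `K`. -/
def preOp (K : Set ℕ) (f : ℕ → ℕ) : Op := fun S => {n | n ∈ K ∧ f n ∈ S 0}

theorem preOp_cont (K : Set ℕ) (f : ℕ → ℕ) : (preOp K f).Cont :=
  fun _ => (SC.const _).and (SC.mem 0 _)

theorem Closed.pre {B : Set Op} {𝒮 : Set (Set ℕ)} (h : Closed B 𝒮) {K : Set ℕ} {f : ℕ → ℕ}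
    (hK : preOp K f ∈ B) {A : Set ℕ} (hA : A ∈ 𝒮) : {n | n ∈ K ∧ f n ∈ A} ∈ 𝒮 :=
  h.base hK hA hA hA hA

/-- Constant operations. -/
def constOp (K : Set ℕ) : Op := fun _ => K

theorem constOp_cont (K : Set ℕ) : (constOp K).Cont := fun _ => SC.const _

theorem Closed.const {B : Set Op} {𝒮 : Set (Set ℕ)} (h : Closed B 𝒮) {K : Set ℕ}
    (hK : constOp K ∈ B) : K ∈ 𝒮 :=
  h.base hK h.empty h.empty h.empty h.empty

/-- A set of the class is listed by the operator that ignores its oracle. -/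
theorem subset_adjoin {B : Set Op} {𝒮 : Set (Set ℕ)} (h : Closed B 𝒮)
    (hB : preOp Set.univ (fun m => m.unpair.2) ∈ B) (f : ℕ → ℕ) : 𝒮 ⊆ adjoin 𝒮 f := by
  intro A hA
  refine ⟨_, h.pre hB hA, ?_⟩
  ext n; simp [out]

/-- `d` is met by every total relation of `𝒮`. -/
def Fair (d : Set ℕ) (𝒮 : Set (Set ℕ)) : Prop :=
  ∀ A ∈ 𝒮, (∀ e, ∃ v, Nat.pair e v ∈ A) → (A ∩ d).Nonempty

theorem Fair.iUnion {d : Set ℕ} {𝒮 : ℕ → Set (Set ℕ)} (h : ∀ k, Fair d (𝒮 k)) :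
    Fair d (⋃ k, 𝒮 k) := by
  intro A hA
  obtain ⟨k, hk⟩ := Set.mem_iUnion.1 hA
  exact h k A hk

/-! ### Forcing with finite chains and infinite reservoirs -/

/-- A sequence of stronger and stronger conditions, the `k`-th of which meets the `k`-th
requirement, together with the function that it determines. -/
theorem exists_generic {P : Type*} (Ext : P → P → Prop) (F : P → List ℕ) (hrefl : ∀ p, Ext p p)
    (htrans : ∀ {p q r}, Ext p q → Ext q r → Ext p r) (hF : ∀ {p q}, Ext p q → F p <+: F q)
    {D : ℕ → P → Prop}
    (hstep : ∀ p k, ∃ q, Ext p q ∧ (F p).length < (F q).length ∧ D k q) (p₀ : P) :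
    ∃ (g : ℕ → ℕ) (p : ℕ → P), (∀ k, D k (p (k + 1))) ∧ (∀ k l, k ≤ l → Ext (p k) (p l)) ∧
      (∀ k, k ≤ (F (p k)).length) ∧ ∀ k, F (p k) = res g (F (p k)).length := by
  choose next hnext hlen hdec using hstep
  let p : ℕ → P := fun k => Nat.rec p₀ (fun k q => next q k) k
  have hmono : ∀ k l, k ≤ l → Ext (p k) (p l) := fun k l hkl => by
    induction l, hkl using Nat.le_induction with
    | base => exact hrefl _
    | succ l _ ih => exact htrans ih (hnext _ _)
  have hl : ∀ k, k ≤ (F (p k)).length := fun k => by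
    induction k with
    | zero => exact Nat.zero_le _
    | succ k ih => exact lt_of_le_of_lt ih (hlen (p k) k)
  -- Condition `p (i + 1)` has length at least `i + 1`, so its entry `i` exists; the prefix relation
  -- makes it agree with every other condition that has this entry.
  refine ⟨fun i => (F (p (i + 1)))[i]'(hl (i + 1)), p, fun k => hdec _ _, hmono, hl, fun k =>
    List.ext_getElem (by simp) fun i h₁ h₂ => ?_⟩
  rw [getElem_res]
  rcases le_total k (i + 1) with h | h
  · exact (hF (hmono _ _ h)).getElem h₁
  · exact ((hF (hmono _ _ h)).getElem (hl (i + 1))).symm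

/-- The finite sequence is a chain of the (coded) relation `Q`. -/
def IsChain (Q : Set ℕ) (l : List ℕ) : Prop := l.Pairwise fun a b => Nat.pair a b ∈ Q

/-- The elements of the first argument above all members of `F`. -/
def aboveOp (F : List ℕ) : Op := fun S => {y | y ∈ S 0 ∧ ∀ a ∈ F, Nat.pair a y ∈ S 1}

/-- The last elements of chains extending `F` on which the operator meets the third argument. -/
def hitOp (F : List ℕ) : Op := fun S =>
  {b | b ∈ S 0 ∧ ∃ E : List ℕ, (∀ a ∈ E, a ∈ S 0) ∧ IsChain (S 1) (F ++ E ++ [b]) ∧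
    ∃ n, n ∈ S 2 ∧ n ∈ outAt (S 3) (F ++ E ++ [b])}

/-- Everything that the operator lists on some proper chain extension of `F`. -/
def possibleOp (F : List ℕ) : Op := fun S =>
  {n | ∃ (E : List ℕ) (b : ℕ), b ∈ S 0 ∧ (∀ a ∈ E, a ∈ S 0) ∧ IsChain (S 1) (F ++ E ++ [b]) ∧
    n ∈ outAt (S 3) (F ++ E ++ [b])}

def forcingOps : Set Op :=
  Set.range aboveOp ∪ Set.range hitOp ∪ Set.range possibleOp ∪
    Set.range fun N : ℕ => preOp {n | N < n} id

theorem forcingOps_countable : forcingOps.Countable :=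
  (((Set.countable_range _).union (Set.countable_range _)).union (Set.countable_range _)).union
    (Set.countable_range _)

theorem SC.isChain (i : Fin 4) (l : List ℕ) : SC fun S : Fin 4 → Set ℕ => IsChain (S i) l :=
  SC.pairwise l fun _ _ => SC.mem i _

theorem forcingOps_cont : ∀ Ψ ∈ forcingOps, Ψ.Cont := by
  rintro Ψ (((⟨F, rfl⟩ | ⟨F, rfl⟩) | ⟨F, rfl⟩) | ⟨N, rfl⟩)
  · exact fun n => (SC.mem 0 _).and (SC.ball_list F fun _ => SC.mem 1 _)
  · exact fun n => (SC.mem 0 _).and (SC.exists' fun E => (SC.ball_list E fun _ => SC.mem 0 _).and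
      ((SC.isChain 1 _).and (SC.exists' fun m => (SC.mem 2 _).and (SC.mem_outAt 3 _ _))))
  · exact fun n => SC.exists' fun E => SC.exists' fun b => (SC.mem 0 _).and
      ((SC.ball_list E fun _ => SC.mem 0 _).and ((SC.isChain 1 _).and (SC.mem_outAt 3 _ _)))
  · exact preOp_cont _ _

/-- A finite chain `F` with an infinite reservoir `Z` of elements above `F`. -/
structure Cond (𝒮 : Set (Set ℕ)) (Q Z₀ : Set ℕ) where
  F : List ℕ
  Z : Set ℕ
  mem : Z ∈ 𝒮
  sub : Z ⊆ Z₀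
  inf : Z.Infinite
  subF : ∀ a ∈ F, a ∈ Z₀
  chain : IsChain Q F
  above : ∀ a ∈ F, ∀ y ∈ Z, Nat.pair a y ∈ Q

namespace Cond
variable {𝒮 : Set (Set ℕ)} {Q Z₀ : Set ℕ}

/-- `q` extends `p`. -/
def Ext (p q : Cond 𝒮 Q Z₀) : Prop := (∃ E, q.F = p.F ++ E ∧ ∀ a ∈ E, a ∈ p.Z) ∧ q.Z ⊆ p.Z

theorem Ext.refl (p : Cond 𝒮 Q Z₀) : p.Ext p := ⟨⟨[], by simp⟩, subset_rfl⟩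

theorem Ext.trans {p q r : Cond 𝒮 Q Z₀} (h : p.Ext q) (h' : q.Ext r) : p.Ext r := by
  obtain ⟨⟨E, hE, hEp⟩, hpq⟩ := h
  obtain ⟨⟨E', hE', hEp'⟩, hqr⟩ := h'
  refine ⟨⟨E ++ E', by simp [hE', hE], fun a ha => ?_⟩, hqr.trans hpq⟩
  rcases List.mem_append.1 ha with ha | ha
  exacts [hEp a ha, hpq (hEp' a ha)]

theorem Ext.prefix {p q : Cond 𝒮 Q Z₀} (h : p.Ext q) : p.F <+: q.F := by
  obtain ⟨⟨E, hE, -⟩, -⟩ := h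
  exact hE ▸ List.prefix_append _ _

/-- `p` forces that the operator `A` meets `d`, or that it is not total. -/
def Decides (d A : Set ℕ) (p : Cond 𝒮 Q Z₀) : Prop :=
  (outAt A p.F ∩ d).Nonempty ∨ ∃ e, ∀ q : Cond 𝒮 Q Z₀, p.Ext q → ∀ v, Nat.pair e v ∉ outAt A q.F

theorem Decides.ext {d A : Set ℕ} {p q : Cond 𝒮 Q Z₀} (h : p.Decides d A) (hpq : p.Ext q) :
    q.Decides d A := by
  rcases h with ⟨n, hn, hd⟩ | ⟨e, he⟩
  · exact Or.inl ⟨n, outAt_mono hpq.prefix hn, hd⟩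
  · exact Or.inr ⟨e, fun r hr => he r (hpq.trans hr)⟩

/-- Every infinite set of the class below `Z₀` contains an element whose chains can be continued
in the set. -/
def Extendible (𝒮 : Set (Set ℕ)) (Q Z₀ : Set ℕ) : Prop :=
  ∀ Z ∈ 𝒮, Z ⊆ Z₀ → Z.Infinite → ∃ z ∈ Z, ∀ E : List ℕ, (∀ a ∈ E, a ∈ Z₀) →
    IsChain Q (E ++ [z]) → {y | y ∈ Z ∧ ∀ a ∈ E ++ [z], Nat.pair a y ∈ Q}.Infinite

variable {B : Set Op} (hB : forcingOps ⊆ B) (h𝒮 : Closed B 𝒮) (hQ : Q ∈ 𝒮)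
  (hext : Extendible 𝒮 Q Z₀)
include hB h𝒮 hQ

theorem above_mem {Z : Set ℕ} (hZ : Z ∈ 𝒮) (F : List ℕ) :
    {y | y ∈ Z ∧ ∀ a ∈ F, Nat.pair a y ∈ Q} ∈ 𝒮 :=
  h𝒮.base (Ψ := aboveOp F) (hB (Or.inl (Or.inl (Or.inl ⟨F, rfl⟩)))) hZ hQ hQ hQ

include hext

/-- In any infinite part of the reservoir consisting of last elements of chain extensions, one of
these extensions can be chosen. -/
theorem exists_ext (p : Cond 𝒮 Q Z₀) {Z : Set ℕ} (hZ : Z ∈ 𝒮) (hZp : Z ⊆ p.Z) (hinf : Z.Infinite) :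
    ∃ b ∈ Z, ∀ E : List ℕ, (∀ a ∈ E, a ∈ p.Z) → IsChain Q (p.F ++ E ++ [b]) →
      ∃ q : Cond 𝒮 Q Z₀, p.Ext q ∧ q.F = p.F ++ E ++ [b] := by
  -- The point `b` is found before the chain leading to it is known: extendibility is uniform in
  -- `E`. Hence `hitOp` need only record last elements.
  obtain ⟨b, hb, h⟩ := hext Z hZ (hZp.trans p.sub) hinf
  refine ⟨b, hb, fun E hE hc => ?_⟩
  have hF : ∀ a ∈ p.F ++ E, a ∈ Z₀ := fun a ha => by
    rcases List.mem_append.1 ha with ha | ha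
    exacts [p.subF a ha, p.sub (hE a ha)]
  refine ⟨⟨p.F ++ E ++ [b], _, above_mem hB h𝒮 hQ hZ (p.F ++ E ++ [b]),
    fun y hy => p.sub (hZp hy.1), h _ hF hc, fun a ha => ?_, hc, fun a ha y hy => hy.2 a ha⟩,
    ⟨⟨E ++ [b], by simp, fun a ha => ?_⟩, fun y hy => hZp hy.1⟩, rfl⟩
  · rcases List.mem_append.1 ha with ha | ha
    · exact hF a ha
    · rw [List.mem_singleton.1 ha]; exact p.sub (hZp hb)
  · rcases List.mem_append.1 ha with ha | ha
    · exact hE a ha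
    · rw [List.mem_singleton.1 ha]; exact hZp hb

theorem exists_longer (p : Cond 𝒮 Q Z₀) :
    ∃ q : Cond 𝒮 Q Z₀, p.Ext q ∧ p.F.length < q.F.length := by
  obtain ⟨b, hb, h⟩ := exists_ext hB h𝒮 hQ hext p p.mem subset_rfl p.inf
  obtain ⟨q, hq, hqF⟩ := h [] (by simp) (by
    simp only [List.append_nil, IsChain, List.pairwise_append, List.pairwise_singleton,
      List.mem_singleton, forall_eq, true_and]
    exact ⟨p.chain, fun a ha => p.above a ha b hb⟩)
  exact ⟨q, hq, by simp [hqF]⟩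

/-- Since `d` is in `𝒮`, so is the set of last elements of chain extensions on which `A` meets `d`.
If it is infinite, one of these extensions can be taken; if it is finite, the reservoir is thinned
past it and fairness yields an argument `e` at which `A` can no longer list anything. -/
theorem exists_decides {d : Set ℕ} (hd : d ∈ 𝒮) (hfair : Fair d 𝒮) {A : Set ℕ} (hA : A ∈ 𝒮)
    (p : Cond 𝒮 Q Z₀) : ∃ q : Cond 𝒮 Q Z₀, p.Ext q ∧ q.Decides d A := by
  have hH : hitOp p.F ![p.Z, Q, d, A] ∈ 𝒮 :=
    h𝒮.base (hB (Or.inl (Or.inl (Or.inr ⟨p.F, rfl⟩)))) p.mem hQ hd hA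
  by_cases hfin : (hitOp p.F ![p.Z, Q, d, A]).Infinite
  · obtain ⟨b, ⟨hb, E, hE, hc, n, hnd, hn⟩, h⟩ :=
      exists_ext hB h𝒮 hQ hext p hH (fun b hb => hb.1) hfin
    obtain ⟨q, hq, hqF⟩ := h E hE hc
    exact ⟨q, hq, Or.inl ⟨n, hqF ▸ hn, hnd⟩⟩
  · obtain ⟨N, hN⟩ := (Set.not_infinite.1 hfin).bddAbove
    have hZ : {n | n ∈ {n | N < n} ∧ id n ∈ p.Z} ∈ 𝒮 := h𝒮.pre (hB (Or.inr ⟨N, rfl⟩)) p.mem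
    have hsub : {n | n ∈ {n | N < n} ∧ id n ∈ p.Z} ⊆ p.Z := fun n hn => hn.2
    have hinf : {n | n ∈ {n | N < n} ∧ id n ∈ p.Z}.Infinite := by
      refine (p.inf.sdiff (Set.finite_le_nat N)).mono ?_
      rintro n ⟨hn, hnN⟩
      exact ⟨by simpa using hnN, hn⟩
    -- The chain is kept and the reservoir is cut above the bound `N`, so no proper extension taken
    -- from it makes `A` meet `d`.
    let q₀ : Cond 𝒮 Q Z₀ := ⟨p.F, _, hZ, hsub.trans p.sub, hinf, p.subF, p.chain,
      fun a ha y hy => p.above a ha y (hsub hy)⟩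
    have hpq₀ : p.Ext q₀ := ⟨⟨[], by simp [q₀]⟩, hsub⟩
    have hP : possibleOp p.F ![q₀.Z, Q, Q, A] ∈ 𝒮 :=
      h𝒮.base (hB (Or.inl (Or.inr ⟨p.F, rfl⟩))) hZ hQ hQ hA
    -- Were the relation of all possible outputs total, fairness would make one of them lie in `d`,
    -- and the last element of the responsible chain would be at most `N`.
    have hne : ¬ ∀ e, ∃ v, Nat.pair e v ∈ possibleOp p.F ![q₀.Z, Q, Q, A] := by
      intro ht
      obtain ⟨n, ⟨E, b, hb, hE, hc, hn⟩, hnd⟩ := hfair _ hP ht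
      have : b ≤ N := hN ⟨hsub hb, E, fun a ha => hsub (hE a ha), hc, n, hnd, hn⟩
      exact absurd hb.1 (not_lt.2 this)
    push Not at hne
    obtain ⟨e, he⟩ := hne
    -- `possibleOp` speaks of proper extensions only. Lengthening the chain once makes every further
    -- extension `r` proper over `p`.
    obtain ⟨q, hq, hlen⟩ := exists_longer hB h𝒮 hQ hext q₀
    refine ⟨q, hpq₀.trans hq, Or.inr ⟨e, fun r hr v hv => he v ?_⟩⟩
    obtain ⟨⟨E, hE, hEq⟩, -⟩ := hq.trans hr
    obtain ⟨⟨E', hE', -⟩, -⟩ := hr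
    have hne : E ≠ [] := by
      rintro rfl
      have h1 := congrArg List.length hE
      have h2 := congrArg List.length hE'
      simp at h1 h2
      omega
    have hEE : r.F = p.F ++ E.dropLast ++ [E.getLast hne] := by
      rw [hE, List.append_assoc, List.dropLast_append_getLast]
    exact ⟨E.dropLast, E.getLast hne, hEq _ (List.getLast_mem hne),
      fun a ha => hEq a (List.mem_of_mem_dropLast ha), hEE ▸ r.chain, hEE ▸ hv⟩

end Cond

/-- A sufficiently generic infinite chain preserves fairness. -/
theorem exists_fair_chain {B : Set Op} (hB : forcingOps ⊆ B) {𝒮 : Set (Set ℕ)} (h𝒮 : Closed B 𝒮)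
    (hcount : 𝒮.Countable) {d : Set ℕ} (hd : d ∈ 𝒮) (hfair : Fair d 𝒮) {Q Z₀ : Set ℕ} (hQ : Q ∈ 𝒮)
    (hZ₀ : Z₀ ∈ 𝒮) (hinf : Z₀.Infinite) (hext : Cond.Extendible 𝒮 Q Z₀) :
    ∃ g : ℕ → ℕ, (∀ i j, i < j → Nat.pair (g i) (g j) ∈ Q) ∧ (∀ i, g i ∈ Z₀) ∧
      Fair d (adjoin 𝒮 g) := by
  obtain ⟨A, hA⟩ := hcount.exists_eq_range ⟨_, h𝒮.empty⟩
  have hA' : ∀ k, A k ∈ 𝒮 := fun k => hA ▸ ⟨k, rfl⟩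
  have hstep : ∀ (p : Cond 𝒮 Q Z₀) (k : ℕ), ∃ q : Cond 𝒮 Q Z₀,
      p.Ext q ∧ p.F.length < q.F.length ∧ q.Decides d (A k) := by
    intro p k
    obtain ⟨q, hq, hqd⟩ := Cond.exists_decides hB h𝒮 hQ hext hd hfair (hA' k) p
    obtain ⟨r, hr, hrl⟩ := Cond.exists_longer hB h𝒮 hQ hext q
    exact ⟨r, hq.trans hr, hq.prefix.length_le.trans_lt hrl, hqd.ext hr⟩
  obtain ⟨g, p, hdec, hmono, hl, hres⟩ := exists_generic (fun p q : Cond 𝒮 Q Z₀ => p.Ext q) Cond.F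
    Cond.Ext.refl (fun h h' => h.trans h') Cond.Ext.prefix hstep
    ⟨[], Z₀, hZ₀, subset_rfl, hinf, by simp, by simp [IsChain], by simp⟩
  refine ⟨g, fun i j hij => ?_, fun i => (p (i + 1)).subF _ ?_, ?_⟩
  · have h := (p (j + 1)).chain
    rw [hres, IsChain, List.pairwise_iff_getElem] at h
    have hj := hl (j + 1)
    have hij' := h i j (by rw [length_res]; omega) (by rw [length_res]; omega) hij
    rwa [getElem_res, getElem_res] at hij'
  · rw [hres]
    exact mem_res.2 ⟨i, hl (i + 1), rfl⟩
  · rintro _ ⟨A', hA'', rfl⟩ ht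
    obtain ⟨k, rfl⟩ : ∃ k, A k = A' := by rwa [hA] at hA''
    rcases hdec k with ⟨n, hn, hnd⟩ | ⟨e, he⟩
    · rw [hres] at hn
      exact ⟨n, mem_out.2 ⟨_, hn⟩, hnd⟩
    · obtain ⟨v, hv⟩ := ht e
      obtain ⟨m, hm⟩ := mem_out.1 hv
      -- A condition past both the deciding stage `k + 1` and the length `m` of oracle used for the
      -- output.
      refine absurd ?_ (he (p (max (k + 1) m)) (hmono _ _ (le_max_left _ _)) v)
      rw [hres]
      exact outAt_mono (res_prefix g ((le_max_right _ _).trans (hl _))) hm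

/-- A transitive relation contained in `<` has, within any infinite `D`, an infinite chain or an
infinite antichain that preserves fairness. -/
theorem exists_fair_homogeneous {B : Set Op} (hB : forcingOps ⊆ B) {𝒮 : Set (Set ℕ)}
    (h𝒮 : Closed B 𝒮) (hcount : 𝒮.Countable) {d : Set ℕ} (hd : d ∈ 𝒮) (hfair : Fair d 𝒮)
    {R : ℕ → ℕ → Prop} (htrans : ∀ a b c, R a b → R b c → R a c)
    (hR : {n : ℕ | n.unpair.1 < n.unpair.2 ∧ R n.unpair.1 n.unpair.2} ∈ 𝒮)
    (hR' : {n : ℕ | n.unpair.1 < n.unpair.2 ∧ ¬ R n.unpair.1 n.unpair.2} ∈ 𝒮)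
    {D : Set ℕ} (hD : D ∈ 𝒮) (hinf : D.Infinite) :
    ∃ g : ℕ → ℕ, StrictMono g ∧ (∀ i, g i ∈ D) ∧ Fair d (adjoin 𝒮 g) ∧
      ((∀ i j, i < j → R (g i) (g j)) ∨ ∀ i j, i < j → ¬ R (g i) (g j)) := by
  -- Either extendibility for `R` holds within `D`, and `R`-chains are built, or it fails on some
  -- infinite `Z₀`, below which antichains are built.
  by_cases hc : ∀ Z ∈ 𝒮, Z ⊆ D → Z.Infinite → ∃ z ∈ Z, {y | y ∈ Z ∧ z < y ∧ R z y}.Infinite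
  · obtain ⟨g, hg, hgD, hgf⟩ := exists_fair_chain hB h𝒮 hcount hd hfair hR hD hinf (by
      intro Z hZ hZD hZi
      obtain ⟨z, hz, hzi⟩ := hc Z hZ hZD hZi
      -- By transitivity, whatever lies above the last element `z` lies above the whole chain.
      refine ⟨z, hz, fun E _ hE => hzi.mono ?_⟩
      rintro y ⟨hy, hzy, hr⟩
      refine ⟨hy, fun a ha => ?_⟩
      simp only [IsChain, List.pairwise_append, List.mem_singleton, forall_eq] at hE
      rcases List.mem_append.1 ha with ha | ha
      · have := hE.2.2 a ha
        simp only [Set.mem_ofPred_eq, Nat.unpair_pair] at this ⊢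
        exact ⟨this.1.trans hzy, htrans _ _ _ this.2 hr⟩
      · rw [List.mem_singleton.1 ha]
        simpa using ⟨hzy, hr⟩)
    simp only [Set.mem_ofPred_eq, Nat.unpair_pair] at hg
    exact ⟨g, fun i j hij => (hg i j hij).1, hgD, hgf, Or.inl fun i j hij => (hg i j hij).2⟩
  · push Not at hc
    obtain ⟨Z₀, hZ₀, hZD, hZi, hz⟩ := hc
    obtain ⟨g, hg, hgD, hgf⟩ := exists_fair_chain hB h𝒮 hcount hd hfair hR' hZ₀ hZi (by
      intro Z hZ hZZ hZi
      obtain ⟨z, hzZ⟩ := hZi.nonempty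
      refine ⟨z, hzZ, fun E hEZ _ => ?_⟩
      -- Every element of `Z₀` has only finitely many `R`-successors in `Z₀`, so a finite subset of
      -- `Z₀` excludes only finitely many points as continuations of an antichain.
      have hfin : {y | ∃ a ∈ E ++ [z], y ≤ a ∨ (y ∈ Z₀ ∧ a < y ∧ R a y)}.Finite := by
        have : {y | ∃ a ∈ E ++ [z], y ≤ a ∨ (y ∈ Z₀ ∧ a < y ∧ R a y)} =
            ⋃ a ∈ {a | a ∈ E ++ [z]}, ({y | y ≤ a} ∪ {y | y ∈ Z₀ ∧ a < y ∧ R a y}) := by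
          ext y; simp only [Set.mem_ofPred_eq, Set.mem_iUnion, Set.mem_union, exists_prop]
        rw [this]
        refine (List.finite_toSet (E ++ [z])).biUnion fun a ha => (Set.finite_le_nat a).union ?_
        refine hz a ?_
        rcases List.mem_append.1 ha with ha | ha
        · exact hEZ a ha
        · rw [List.mem_singleton.1 ha]; exact hZZ hzZ
      refine (hZi.sdiff hfin).mono ?_
      rintro y ⟨hy, hny⟩
      refine ⟨hy, fun a ha => ?_⟩
      simp only [Set.mem_ofPred_eq, Nat.unpair_pair] at hny ⊢
      push Not at hny
      exact ⟨(hny a ha).1, (hny a ha).2 (hZZ hy) (hny a ha).1⟩)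
    simp only [Set.mem_ofPred_eq, Nat.unpair_pair] at hg
    exact ⟨g, fun i j hij => (hg i j hij).1, fun i => hZD (hgD i), hgf,
      Or.inr fun i j hij => (hg i j hij).2⟩

/-! ### A generic tournament -/

/-- The finite set coded by a number. -/
def finOf (v : ℕ) : Finset ℕ := (Denumerable.eqv (Finset ℕ)).symm v

/-- The code of a finite set. -/
def finCode (s : Finset ℕ) : ℕ := Denumerable.eqv (Finset ℕ) s

@[simp] theorem finOf_finCode (s : Finset ℕ) : finOf (finCode s) = s :=
  (Denumerable.eqv (Finset ℕ)).symm_apply_apply s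

/-- The tournament coded by `f`: the first component of `f z` codes the set of the `x < z` that
beat `z`. -/
def Beats (f : ℕ → ℕ) (x y : ℕ) : Prop :=
  (x < y ∧ x ∈ finOf (f y).unpair.1) ∨ (y < x ∧ y ∉ finOf (f x).unpair.1)

/-- The second component of `f i` enumerates the number `n`. -/
def Lists (f : ℕ → ℕ) (i n : ℕ) : Prop := (f i).unpair.2 = n + 1

theorem Beats.total (f : ℕ → ℕ) {x y : ℕ} (h : x ≠ y) : Beats f x y ∨ Beats f y x := by
  unfold Beats
  rcases lt_or_gt_of_ne h with h | h <;> tauto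

theorem Beats.asymm {f : ℕ → ℕ} {x y : ℕ} (h : Beats f x y) : ¬ Beats f y x := by
  unfold Beats at *
  rcases h with h | h <;> rintro (h' | h') <;> first | omega | tauto

theorem Beats.congr {f f' : ℕ → ℕ} {n x y : ℕ} (h : ∀ i < n, f i = f' i) (hx : x < n) (hy : y < n) :
    Beats f x y ↔ Beats f' x y := by
  simp only [Beats, h x hx, h y hy]

/-- The values of `f` below `n` enumerate (the graph of) a partial function and, after `D` has been
enumerated at a sufficiently small place, all new points form a cycle with two elements of `D`. -/
structure Good (f : ℕ → ℕ) (n : ℕ) : Prop where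
  single : ∀ i < n, ∀ j < n, ∀ e v w, Lists f i (Nat.pair e v) → Lists f j (Nat.pair e w) → v = w
  cycle : ∀ z < n, ∀ i < z, ∀ e v, Lists f i (Nat.pair e v) → 2 * e + 2 ≤ (finOf v).card →
    (∀ x ∈ finOf v, x < z) → ∃ x ∈ finOf v, ∃ y ∈ finOf v, Beats f x y ∧ Beats f y z ∧ Beats f z x

theorem Good.congr {f f' : ℕ → ℕ} {n : ℕ} (h : ∀ i < n, f i = f' i) (hf : Good f n) :
    Good f' n := by
  refine ⟨fun i hi j hj e v w => ?_, fun z hz i hi e v hl hc hv => ?_⟩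
  · simp only [Lists, ← h i hi, ← h j hj]
    exact hf.single i hi j hj e v w
  · simp only [Lists, ← h i (hi.trans hz)] at hl
    obtain ⟨x, hx, y, hy, h₁, h₂, h₃⟩ := hf.cycle z hz i hi e v hl hc hv
    have hx' := (hv x hx).trans hz
    have hy' := (hv y hy).trans hz
    exact ⟨x, hx, y, hy, (Beats.congr h hx' hy').1 h₁, (Beats.congr h hy' hz).1 h₂,
      (Beats.congr h hz hx').1 h₃⟩

/-- For finitely many sets of rapidly increasing size, a new point can be put into a cycle with two
elements of each of them. -/
theorem exists_row {T : ℕ → ℕ → Prop} (hT : ∀ x y, x ≠ y → T x y ∨ T y x) (D : ℕ → Finset ℕ)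
    (m : ℕ) : ∃ r W : Finset ℕ, W.card ≤ 2 * m ∧ ∀ e < m, 2 * e + 2 ≤ (D e).card →
      ∃ x ∈ D e, ∃ y ∈ D e, x ∈ W ∧ y ∈ W ∧ T x y ∧ y ∈ r ∧ x ∉ r := by
  induction m with
  | zero => exact ⟨∅, ∅, by simp⟩
  | succ m ih =>
    obtain ⟨r, W, hW, h⟩ := ih
    by_cases hm : 2 * m + 2 ≤ (D m).card
    -- The earlier requirements have used at most `2 * m` points `W`, so a set of size `2 * m + 2`
    -- has two points outside `W`.
    · have h2 : 1 < (D m \ W).card := by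
        have := Finset.le_card_sdiff W (D m)
        omega
      obtain ⟨a, ha, b, hb, hab⟩ := Finset.one_lt_card.1 h2
      obtain ⟨x, hx, y, hy, hxy⟩ : ∃ x ∈ D m \ W, ∃ y ∈ D m \ W, x ≠ y ∧ T x y := by
        rcases hT a b hab with h | h
        exacts [⟨a, ha, b, hb, hab, h⟩, ⟨b, hb, a, ha, hab.symm, h⟩]
      rw [Finset.mem_sdiff] at hx hy
      -- With `r` the set of points that beat the new one, this makes `y` beat it and `x` lose to
      -- it. As `x` and `y` are outside `W`, earlier choices are undisturbed.
      refine ⟨insert y r \ {x}, insert x (insert y W), ?_, fun e he hc => ?_⟩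
      · have := Finset.card_insert_le x (insert y W)
        have := Finset.card_insert_le y W
        omega
      · rcases Nat.lt_succ_iff_lt_or_eq.1 he with he | rfl
        · obtain ⟨x', hx', y', hy', hxW, hyW, ht, hyr, hxr⟩ := h e he hc
          refine ⟨x', hx', y', hy', by simp [hxW], by simp [hyW], ht, ?_, ?_⟩
          · have : y' ≠ x := by rintro rfl; exact hx.2 hyW
            simp [this, hyr]
          · have : x' ≠ y := by rintro rfl; exact hy.2 hxW
            simp [this, hxr]
        · exact ⟨x, hx.1, y, hy.1, by simp, by simp, hxy.2, by simp [hxy.1.symm], by simp⟩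
    · refine ⟨r, W, by omega, fun e he hc => ?_⟩
      rcases Nat.lt_succ_iff_lt_or_eq.1 he with he | rfl
      · exact h e he hc
      · exact absurd hc hm

/-- The row of the new point comes from `exists_row` for the finitely many sets listed so far. The
set requested by `c` makes no demand on this point, since `Good` concerns only points strictly after
the listing. -/
theorem Good.exists_succ {f : ℕ → ℕ} {n : ℕ} (hf : Good f n) (c : ℕ)
    (hc : ∀ e v, c = Nat.pair e v + 1 → ∀ i < n, ∀ w, ¬ Lists f i (Nat.pair e w)) :
    ∃ a : ℕ, a.unpair.2 = c ∧ Good (update f n a) (n + 1) := by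
  classical
  -- The default `∅` is too small to impose a requirement.
  let D : ℕ → Finset ℕ := fun e =>
    if h : ∃ v, ∃ i < n, Lists f i (Nat.pair e v) then finOf h.choose else ∅
  have hD : ∀ i < n, ∀ e v, Lists f i (Nat.pair e v) → D e = finOf v := fun i hi e v hl => by
    have h : ∃ v, ∃ i < n, Lists f i (Nat.pair e v) := ⟨v, i, hi, hl⟩
    obtain ⟨j, hj, hl'⟩ := h.choose_spec
    simp only [D, dif_pos h]
    rw [hf.single j hj i hi e _ _ hl' hl]
  obtain ⟨m, hm⟩ : ∃ m, ∀ i < n, ∀ e v, Lists f i (Nat.pair e v) → e < m := by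
    obtain ⟨m, hm⟩ := ((Set.finite_lt_nat n).image fun i => (f i).unpair.2).bddAbove
    refine ⟨m + 1, fun i hi e v hl => ?_⟩
    have h : (f i).unpair.2 ≤ m := hm ⟨i, hi, rfl⟩
    rw [hl] at h
    have := Nat.left_le_pair e v
    omega
  obtain ⟨r, W, -, hr⟩ := exists_row (T := Beats f) (fun _ _ => Beats.total f) D m
  have hrow : finOf (Nat.pair (finCode r) c).unpair.1 = r := by simp
  refine ⟨Nat.pair (finCode r) c, by simp, ?_, ?_⟩
  · intro i hi j hj e v w
    simp only [Lists, update_apply]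
    split_ifs with h₁ h₂ h₂
    · intro h h'
      have := h.symm.trans h'
      simpa [Nat.pair_eq_pair] using this
    · intro h h'
      exact absurd h' (hc e v (by simpa using h) j (by omega) w)
    · intro h h'
      exact absurd h (hc e w (by simpa using h') i (by omega) v)
    · exact hf.single i (by omega) j (by omega) e v w
  · intro z hz i hi e v hl hcard hv
    have hfi : ∀ i < n, f i = update f n (Nat.pair (finCode r) c) i := fun i hi =>
      (update_of_ne hi.ne _ _).symm
    have hl' : Lists f i (Nat.pair e v) := by
      rwa [Lists, hfi i (by omega)]
    rcases Nat.lt_succ_iff_lt_or_eq.1 hz with hz | rfl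
    · obtain ⟨x, hx, y, hy, h₁, h₂, h₃⟩ := hf.cycle z hz i hi e v hl' hcard hv
      have hx' := (hv x hx).trans hz
      have hy' := (hv y hy).trans hz
      exact ⟨x, hx, y, hy, (Beats.congr hfi hx' hy').1 h₁, (Beats.congr hfi hy' hz).1 h₂,
        (Beats.congr hfi hz hx').1 h₃⟩
    · have hDe := hD i hi e v hl'
      obtain ⟨x, hx, y, hy, -, -, ht, hyr, hxr⟩ :=
        hr e (hm i hi e v hl') (by rw [hDe]; exact hcard)
      rw [hDe] at hx hy
      refine ⟨x, hx, y, hy, (Beats.congr hfi (hv x hx) (hv y hy)).1 ht, Or.inl ⟨hv y hy, ?_⟩,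
        Or.inr ⟨hv x hx, ?_⟩⟩
      · simpa only [update_self, hrow] using hyr
      · simpa only [update_self, hrow] using hxr

/-- The function that continues a finite sequence with zeros. -/
def ofList (σ : List ℕ) (i : ℕ) : ℕ := σ.getD i 0

theorem ofList_res {f : ℕ → ℕ} {n i : ℕ} (hi : i < n) : ofList (res f n) i = f i := by
  simp [ofList, res, hi]

theorem ofList_prefix {σ τ : List ℕ} (h : σ <+: τ) {i : ℕ} (hi : i < σ.length) :
    ofList σ i = ofList τ i := by
  have hi' : i < τ.length := hi.trans_le h.length_le
  simp [ofList, hi, hi', h.getElem hi]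

/-- A good finite sequence together with a finite set of numbers at which the enumerated partial
function is to stay undefined. -/
structure TCond where
  F : List ℕ
  avoid : Finset ℕ
  good : Good (ofList F) F.length

namespace TCond

/-- `q` extends `p`. -/
structure Ext (p q : TCond) : Prop where
  pre : p.F <+: q.F
  sub : p.avoid ⊆ q.avoid
  obeys : ∀ i, p.F.length ≤ i → i < q.F.length → ∀ e ∈ p.avoid, ∀ v,
    ¬ Lists (ofList q.F) i (Nat.pair e v)

theorem Ext.refl (p : TCond) : p.Ext p :=
  ⟨List.prefix_rfl, subset_rfl, fun _ h h' => absurd h (not_le.2 h')⟩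

theorem Ext.trans {p q r : TCond} (h : p.Ext q) (h' : q.Ext r) : p.Ext r := by
  refine ⟨h.pre.trans h'.pre, h.sub.trans h'.sub, fun i hi hir e he v => ?_⟩
  rcases lt_or_ge i q.F.length with hq | hq
  · rw [Lists, ← ofList_prefix h'.pre hq]
    exact h.obeys i hi hq e he v
  · exact h'.obeys i hq hir e (h.sub he) v

theorem exists_append (p : TCond) (c : ℕ) (hc : ∀ e v, c = Nat.pair e v + 1 →
    ∀ i < p.F.length, ∀ w, ¬ Lists (ofList p.F) i (Nat.pair e w)) :
    ∃ a : ℕ, a.unpair.2 = c ∧ Good (ofList (p.F ++ [a])) (p.F ++ [a]).length := by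
  obtain ⟨a, ha, h⟩ := p.good.exists_succ c hc
  refine ⟨a, ha, ?_⟩
  rw [List.length_append, List.length_singleton]
  refine h.congr fun i hi => ?_
  rcases Nat.lt_succ_iff_lt_or_eq.1 hi with hi | rfl
  · rw [update_of_ne hi.ne, ofList_prefix (List.prefix_append _ _) hi]
  · simp [ofList]

theorem exists_longer (p : TCond) : ∃ q : TCond, p.Ext q ∧ p.F.length < q.F.length := by
  -- The value `0` lists nothing, so it violates no promise in `avoid`.
  obtain ⟨a, ha, h⟩ := p.exists_append 0 (by simp)
  refine ⟨⟨p.F ++ [a], p.avoid, h⟩, ⟨List.prefix_append _ _, subset_rfl, ?_⟩, by simp⟩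
  intro i hi hi' e _ v
  have : i = p.F.length := by simp at hi'; omega
  subst this
  simp [Lists, ofList, ha]

/-- `p` forces that the operator `A` lists an enumerated number, or that it is not total. -/
def Decides (A : Set ℕ) (p : TCond) : Prop :=
  (∃ n ∈ outAt A p.F, ∃ i < p.F.length, Lists (ofList p.F) i n) ∨
    ∃ e, ∀ q : TCond, p.Ext q → ∀ v, Nat.pair e v ∉ outAt A q.F

theorem Decides.ext {A : Set ℕ} {p q : TCond} (h : p.Decides A) (hpq : p.Ext q) :
    q.Decides A := by
  rcases h with ⟨n, hn, i, hi, hl⟩ | ⟨e, he⟩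
  · refine Or.inl ⟨n, outAt_mono hpq.pre hn, i, hi.trans_le hpq.pre.length_le, ?_⟩
    rwa [Lists, ← ofList_prefix hpq.pre hi]
  · exact Or.inr ⟨e, fun r hr => he r (hpq.trans hr)⟩

/-- Pick a fresh `e` and promise not to list anything at `e`. If some extension keeping the promise
makes `A` list a pair at `e`, the promise is given up and that very pair is listed next; otherwise
the promise forces `A` to be undefined at `e`. -/
theorem exists_decides (p : TCond) (A : Set ℕ) : ∃ q : TCond, p.Ext q ∧ q.Decides A := by
  classical
  obtain ⟨e, hep, heF⟩ : ∃ e, e ∉ p.avoid ∧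
      ∀ i < p.F.length, ∀ v, ¬ Lists (ofList p.F) i (Nat.pair e v) := by
    obtain ⟨m, hm⟩ :=
      ((Set.finite_lt_nat p.F.length).image fun i => (ofList p.F i).unpair.2).bddAbove
    obtain ⟨m', hm'⟩ := p.avoid.finite_toSet.bddAbove
    refine ⟨max m m' + 1, fun h => ?_, fun i hi v hl => ?_⟩
    · have := hm' h
      omega
    · have h : (ofList p.F i).unpair.2 ≤ m := hm ⟨i, hi, rfl⟩
      rw [hl] at h
      have := Nat.left_le_pair (max m m' + 1) v
      omega
  let p' : TCond := ⟨p.F, insert e p.avoid, p.good⟩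
  have hp' : p.Ext p' := ⟨List.prefix_rfl, Finset.subset_insert _ _,
    fun i h h' => absurd h (not_le.2 h')⟩
  by_cases h : ∃ q : TCond, p'.Ext q ∧ ∃ v, Nat.pair e v ∈ outAt A q.F
  · obtain ⟨q, hq, v, hv⟩ := h
    have hun : ∀ i < q.F.length, ∀ w, ¬ Lists (ofList q.F) i (Nat.pair e w) := fun i hi w => by
      rcases lt_or_ge i p.F.length with hip | hip
      · rw [Lists, ← ofList_prefix hq.pre hip]
        exact heF i hip w
      · exact hq.obeys i hip hi e (Finset.mem_insert_self _ _) w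
    obtain ⟨a, ha, hgood⟩ := q.exists_append (Nat.pair e v + 1) (fun e' v' h => by
      rw [Nat.add_right_cancel_iff, Nat.pair_eq_pair] at h
      exact h.1 ▸ hun)
    have hpre : q.F <+: q.F ++ [a] := List.prefix_append _ _
    -- The promise about `e` was never part of `p`, so this still extends `p`, though not `p'`.
    refine ⟨⟨q.F ++ [a], p.avoid, hgood⟩, ⟨hq.pre.trans hpre, subset_rfl, ?_⟩,
      Or.inl ⟨Nat.pair e v, outAt_mono hpre hv, q.F.length, by simp, by simp [Lists, ofList, ha]⟩⟩
    intro i hi hi' e' he' w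
    rcases lt_or_ge i q.F.length with hiq | hiq
    · rw [Lists, ← ofList_prefix hpre hiq]
      exact hq.obeys i hi hiq e' (Finset.mem_insert_of_mem he') w
    · have : i = q.F.length := by simp at hi'; omega
      subst this
      simp only [Lists, ofList, List.getD_append_right _ _ _ _ le_rfl, Nat.sub_self,
        List.getD_cons_zero, ha]
      intro h
      rw [Nat.add_right_cancel_iff, Nat.pair_eq_pair] at h
      exact hep (h.1 ▸ he')
  · push Not at h
    exact ⟨p', hp', Or.inr ⟨e, h⟩⟩

end TCond

/-- A generic tournament, together with a generic partial function that is met by every total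
relation of the class it generates. -/
theorem exists_fair_tournament {𝒮 : Set (Set ℕ)} (hcount : 𝒮.Countable) (hne : 𝒮.Nonempty) :
    ∃ f : ℕ → ℕ, (∀ n, Good f n) ∧ Fair {n | ∃ i, Lists f i n} (adjoin 𝒮 f) := by
  obtain ⟨A, hA⟩ := hcount.exists_eq_range hne
  have hstep : ∀ (p : TCond) (k : ℕ), ∃ q : TCond,
      p.Ext q ∧ p.F.length < q.F.length ∧ q.Decides (A k) := by
    intro p k
    obtain ⟨q, hq, hqd⟩ := p.exists_decides (A k)
    obtain ⟨r, hr, hrl⟩ := q.exists_longer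
    exact ⟨r, hq.trans hr, hq.pre.length_le.trans_lt hrl, hqd.ext hr⟩
  obtain ⟨f, p, hdec, hmono, hl, hres⟩ := exists_generic TCond.Ext TCond.F
    TCond.Ext.refl (fun h h' => h.trans h') TCond.Ext.pre hstep
    ⟨[], ∅, ⟨by simp, by simp⟩⟩
  have hf : ∀ k, ∀ i < (p k).F.length, ofList (p k).F i = f i := fun k i hi => by
    rw [hres, ofList_res hi]
  refine ⟨f, fun n => ?_, ?_⟩
  · have h := (p n).good.congr (hf n)
    exact ⟨fun i hi j hj => h.single i (hi.trans_le (hl n)) j (hj.trans_le (hl n)),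
      fun z hz => h.cycle z (hz.trans_le (hl n))⟩
  · rintro _ ⟨A', hA', rfl⟩ ht
    obtain ⟨k, rfl⟩ : ∃ k, A k = A' := by rwa [hA] at hA'
    rcases hdec k with ⟨n, hn, i, hi, hli⟩ | ⟨e, he⟩
    · rw [hres] at hn
      refine ⟨n, mem_out.2 ⟨_, hn⟩, i, ?_⟩
      rwa [Lists, ← hf _ i hi]
    · obtain ⟨v, hv⟩ := ht e
      obtain ⟨m, hm⟩ := mem_out.1 hv
      refine absurd ?_ (he (p (max (k + 1) m)) (hmono _ _ (le_max_left _ _)) v)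
      rw [hres]
      exact outAt_mono (res_prefix f ((le_max_right _ _).trans (hl _))) hm

/-! ### Arithmetical operations and the axioms of `RCA₀` -/

/-- An injective coding of terms by numbers. -/
def Tm.code : Tm → ℕ
  | var x => Nat.pair 0 x
  | zero => Nat.pair 1 0
  | one => Nat.pair 2 0
  | add t u => Nat.pair 3 (Nat.pair t.code u.code)
  | mul t u => Nat.pair 4 (Nat.pair t.code u.code)

theorem Tm.code_injective : Injective Tm.code := by
  intro t
  induction t with
  | var x => intro u h; cases u <;> simp_all [code, Nat.pair_eq_pair]
  | zero => intro u h; cases u <;> simp_all [code, Nat.pair_eq_pair]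
  | one => intro u h; cases u <;> simp_all [code, Nat.pair_eq_pair]
  | add t t' ih ih' =>
    intro u h
    cases u <;> simp only [code, Nat.pair_eq_pair] at h <;> try omega
    rw [ih h.2.1, ih' h.2.2]
  | mul t t' ih ih' =>
    intro u h
    cases u <;> simp only [code, Nat.pair_eq_pair] at h <;> try omega
    rw [ih h.2.1, ih' h.2.2]

instance : Countable Tm := Tm.code_injective.countable

theorem exists_assignment : ∃ c : ℕ → (ℕ →₀ ℕ), Surjective c := exists_surjective_nat _

/-- The finitely supported assignment coded by a number. -/
noncomputable def asg : ℕ → (ℕ →₀ ℕ) := exists_assignment.choose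

/-- A code of a finitely supported assignment. -/
noncomputable def asgCode : (ℕ →₀ ℕ) → ℕ := surjInv exists_assignment.choose_spec

@[simp] theorem asg_asgCode (e : ℕ →₀ ℕ) : asg (asgCode e) = e := surjInv_eq _ e

/-- The code of the assignment modified at `x`. -/
noncomputable def upd (n x a : ℕ) : ℕ := asgCode ((asg n).update x a)

@[simp] theorem asg_upd (n x a : ℕ) : (asg (upd n x a) : ℕ → ℕ) = update (asg n) x a := by
  simp [upd]

def interOp : Op := fun S => {n | n ∈ S 0 ∧ n ∈ S 1}

def unionOp : Op := fun S => {n | n ∈ S 0 ∨ n ∈ S 1}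

noncomputable def ballOp (p : ℕ × Tm) : Op :=
  fun S => {n | ∀ a < p.2.val (asg n), upd n p.1 a ∈ S 0}

noncomputable def bexOp (p : ℕ × Tm) : Op :=
  fun S => {n | ∃ a, a < p.2.val (asg n) ∧ upd n p.1 a ∈ S 0}

noncomputable def exOp (x : ℕ) : Op := fun S => {n | ∃ a, upd n x a ∈ S 0}

def logicOps : Set Op :=
  {interOp} ∪ {unionOp} ∪ Set.range ballOp ∪ Set.range bexOp ∪ Set.range exOp ∪
  (Set.range fun p : Tm × Tm => constOp {n | p.1.val (asg n) = p.2.val (asg n)}) ∪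
  (Set.range fun p : Tm × Tm => constOp {n | ¬ p.1.val (asg n) = p.2.val (asg n)}) ∪
  (Set.range fun p : Tm × Tm => constOp {n | p.1.val (asg n) < p.2.val (asg n)}) ∪
  (Set.range fun p : Tm × Tm => constOp {n | ¬ p.1.val (asg n) < p.2.val (asg n)}) ∪
  (Set.range fun t : Tm => preOp Set.univ fun n => t.val (asg n)) ∪
  (Set.range fun p : (ℕ →₀ ℕ) × ℕ => preOp Set.univ fun k => asgCode (p.1.update p.2 k))

theorem logicOps_countable : logicOps.Countable := by
  unfold logicOps
  simp only [Set.countable_union, Set.countable_range, Set.countable_singleton, and_self]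

theorem logicOps_cont : ∀ Ψ ∈ logicOps, Ψ.Cont := by
  rintro Ψ ((((((((((rfl | rfl) | ⟨p, rfl⟩) | ⟨p, rfl⟩) | ⟨x, rfl⟩) | ⟨p, rfl⟩) | ⟨p, rfl⟩) |
    ⟨p, rfl⟩) | ⟨p, rfl⟩) | ⟨t, rfl⟩) | ⟨p, rfl⟩)
  · exact fun n => (SC.mem 0 _).and (SC.mem 1 _)
  · exact fun n => (SC.mem 0 _).or (SC.mem 1 _)
  · exact fun n => SC.ball_lt _ fun a => SC.mem 0 _
  · exact fun n => SC.exists' fun a => (SC.const _).and (SC.mem 0 _)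
  · exact fun n => SC.exists' fun a => SC.mem 0 _
  · exact constOp_cont _
  · exact constOp_cont _
  · exact constOp_cont _
  · exact constOp_cont _
  · exact preOp_cont _ _
  · exact preOp_cont _ _

section logic
variable {B : Set Op} {𝒮 : Set (Set ℕ)} (h : Closed B 𝒮) (hB : logicOps ⊆ B)
include h hB

/-- The set and its complement are treated together because negation exchanges them; a bounded
quantifier is continuous in either form. -/
theorem Closed.sat_sigma00 {M : Set (Set ℕ)} {θ : Fm} (hθ : Sigma00 θ) {s : ℕ → Set ℕ}
    (hs : ∀ X, s X ∈ dec 𝒮) :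
    {n | Sat M (asg n) s θ} ∈ 𝒮 ∧ {n | ¬ Sat M (asg n) s θ} ∈ 𝒮 := by
  induction hθ with
  | eq t u =>
    exact ⟨h.const (hB (Or.inl (Or.inl (Or.inl (Or.inl (Or.inl (Or.inr ⟨(t, u), rfl⟩))))))),
      h.const (hB (Or.inl (Or.inl (Or.inl (Or.inl (Or.inr ⟨(t, u), rfl⟩))))))⟩
  | lt t u =>
    exact ⟨h.const (hB (Or.inl (Or.inl (Or.inl (Or.inr ⟨(t, u), rfl⟩))))),
      h.const (hB (Or.inl (Or.inl (Or.inr ⟨(t, u), rfl⟩))))⟩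
  | mem t X =>
    have hop : preOp Set.univ (fun n => t.val (asg n)) ∈ B := hB (by simp [logicOps])
    have h₁ := h.pre hop (hs X).1
    have h₂ := h.pre hop (hs X).2
    simp only [Set.mem_univ, true_and] at h₁ h₂
    exact ⟨h₁, h₂⟩
  | neg _ ih => exact ⟨ih.2, by simpa only [Sat, not_not] using ih.1⟩
  | imp _ _ ih₁ ih₂ =>
    have h₁ := h.base (Ψ := unionOp) (hB (by simp [logicOps])) ih₁.2 ih₂.1 ih₁.1 ih₁.1
    have h₂ := h.base (Ψ := interOp) (hB (by simp [logicOps])) ih₁.1 ih₂.2 ih₁.1 ih₁.1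
    refine ⟨?_, ?_⟩
    · convert h₁ using 1
      ext n
      simp [unionOp, Sat, imp_iff_not_or]
    · convert h₂ using 1
      ext n
      simp [interOp, Sat]
  | @ball φ x t hx _ ih =>
    have h₁ := h.base (Ψ := ballOp (x, t)) (hB (by simp [logicOps])) ih.1 ih.1 ih.1 ih.1
    have h₂ := h.base (Ψ := bexOp (x, t)) (hB (by simp [logicOps])) ih.2 ih.1 ih.1 ih.1
    refine ⟨?_, ?_⟩
    · convert h₁ using 1
      ext n
      simp [ballOp, Sat, Tm.val_update hx, Tm.val]
    · convert h₂ using 1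
      ext n
      simp [bexOp, Sat, Tm.val_update hx, Tm.val]
  | @bex φ x t hx _ ih =>
    have h₁ := h.base (Ψ := ballOp (x, t)) (hB (by simp [logicOps])) ih.2 ih.1 ih.1 ih.1
    have h₂ := h.base (Ψ := bexOp (x, t)) (hB (by simp [logicOps])) ih.1 ih.1 ih.1 ih.1
    refine ⟨?_, ?_⟩
    · convert h₂ using 1
      ext n
      simp [bexOp, Sat, Tm.val_update hx, Tm.val]
    · convert h₁ using 1
      ext n
      simp [ballOp, Sat, Tm.val_update hx, Tm.val]

/-- One unbounded existential quantifier is an operation of the class; pulling back along `k ↦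
asgCode (e.update n k)` then fixes the parameters and leaves `n` free. -/
theorem Closed.section_mem {A : Set ℕ} (hA : A ∈ 𝒮) (e : ℕ →₀ ℕ) (n x : ℕ) :
    {k | ∃ a, upd (asgCode (e.update n k)) x a ∈ A} ∈ 𝒮 := by
  have h₁ := h.base (Ψ := exOp x) (hB (by simp [logicOps])) hA hA hA hA
  have h₂ := h.pre (K := Set.univ) (f := fun k => asgCode (e.update n k))
    (hB (Or.inr ⟨(e, n), rfl⟩)) h₁
  simpa [exOp] using h₂

theorem Closed.section_sat {M : Set (Set ℕ)} {s : ℕ → Set ℕ} (hs : ∀ X, s X ∈ dec 𝒮)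
    (e : ℕ →₀ ℕ) (n : ℕ) {φ ψ : Fm} (hφ : Sigma01 φ) (hψ : Pi01 ψ) :
    {k | Sat M (update e n k) s φ} ∈ 𝒮 ∧ {k | ¬ Sat M (update e n k) s ψ} ∈ 𝒮 := by
  obtain ⟨x, θ, hθ, rfl⟩ := hφ
  obtain ⟨y, η, hη, rfl⟩ := hψ
  have h₁ := h.section_mem hB (h.sat_sigma00 hB (M := M) hθ hs).1 e n x
  have h₂ := h.section_mem hB (h.sat_sigma00 hB (M := M) hη hs).2 e n y
  simp only [Set.mem_ofPred_eq, asg_upd, asg_asgCode, Finsupp.coe_update] at h₁ h₂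
  exact ⟨by simpa only [sat_ex] using h₁, by simpa only [Sat, not_forall] using h₂⟩

end logic

theorem Fm.freeFor_zero (x : ℕ) (φ : Fm) : FreeFor Tm.zero x φ := by
  induction φ with
  | imp φ ψ ihφ ihψ => exact ⟨ihφ, ihψ⟩
  | all y φ ih => exact Or.inr ⟨fun h => h, ih⟩
  | neg φ ih => exact ih
  | allS X φ ih => exact ih
  | _ => trivial

theorem Fm.freeFor_succ (x : ℕ) (φ : Fm) : FreeFor (Tm.add (Tm.var x) Tm.one) x φ := by
  induction φ with
  | imp φ ψ ihφ ihψ => exact ⟨ihφ, ihψ⟩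
  | all y φ ih =>
    by_cases hy : x = y
    · exact Or.inl fun h => h.1 hy
    · exact Or.inr ⟨fun h => by rcases h with h | h; exacts [hy h.symm, h], ih⟩
  | neg φ ih => exact ih
  | allS X φ ih => exact ih
  | _ => trivial

/-- Induction is true because the numbers are standard. For comprehension, the `Σ⁰₁` form puts the
set into `𝒮` and the `Π⁰₁` form puts its complement there. -/
theorem Closed.valid_RCA0 {B : Set Op} {𝒮 : Set (Set ℕ)} (h : Closed B 𝒮) (hB : logicOps ⊆ B)
    {φ : Fm} (hφ : RCA0 φ) : Valid (dec 𝒮) φ := by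
  intro e s hs
  cases hφ with
  | basic hφ =>
    cases hφ with
    | lt_succ => simp only [sat_iff, sat_or, Sat, Tm.val]; omega
    | mul_succ => simp only [Sat, Tm.val]; ring
    | add_succ => simp only [Sat, Tm.val]; omega
    | _ => simp [Sat, Tm.val]
  | induction φ n _ =>
    simp only [Sat, sat_and, sat_subst (Fm.freeFor_zero n φ), sat_subst (Fm.freeFor_succ n φ),
      Tm.val, update_self, update_idem]
    rintro ⟨h₀, h₁⟩ a
    induction a with
    | zero => exact h₀
    | succ a ih => exact h₁ a ih
  | comprehension φ ψ n X hφ hψ hX =>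
    intro hiff
    simp only [Sat, sat_iff] at hiff
    obtain ⟨h₁, h₂⟩ := h.section_sat hB (M := dec 𝒮) hs e n hφ hψ
    rw [sat_exS]
    refine ⟨_, ⟨h₁, ?_⟩, fun a => ?_⟩
    · convert h₂ using 1
      ext k
      simp [hiff]
    · rw [sat_iff, sat_updateS hX]
      simp [Sat, Tm.val]

/-! ### The model -/

/-- The coding of pairs used in the principles. -/
def cp (x y : ℕ) : ℕ := (x + y) * (x + y) + x

/-- The code lies between the square of `x + y` and the next square, so it determines `x + y`, and
then `x`. -/
theorem cp_inj {x y x' y' : ℕ} : cp x y = cp x' y' ↔ x = x' ∧ y = y' := by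
  refine ⟨fun h => ?_, by rintro ⟨rfl, rfl⟩; rfl⟩
  have key : ∀ a b a' b' : ℕ, a + b < a' + b' → cp a b < cp a' b' := fun a b a' b' hlt => by
    have := Nat.mul_le_mul (Nat.succ_le_of_lt hlt) (Nat.succ_le_of_lt hlt)
    simp only [cp, Nat.succ_eq_add_one] at *
    nlinarith
  have hs : x + y = x' + y' := by
    rcases lt_trichotomy (x + y) (x' + y') with hlt | heq | hlt
    · exact absurd h (key _ _ _ _ hlt).ne
    · exact heq
    · exact absurd h (key _ _ _ _ hlt).ne'
  simp only [cp, hs] at h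
  omega

theorem left_le_cp (x y : ℕ) : x ≤ cp x y := Nat.le_add_left _ _

theorem right_le_cp (x y : ℕ) : y ≤ cp x y := by
  have := Nat.le_mul_self (x + y)
  unfold cp
  omega

/-! ### Operators recovering the range, graph, tournament and listing from an oracle. -/

/-- The enumeration operator that lists `n` on seeing `σ` when `p σ n`. -/
def operator (p : List ℕ → ℕ → Prop) : Set ℕ := {m | p (seqOf m) m.unpair.2}

theorem out_operator (p : List ℕ → ℕ → Prop) (f : ℕ → ℕ) :
    out (operator p) f = {n | ∃ k, p (res f k) n} := by
  ext n; simp [out, operator]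

def rangeOpr : Set ℕ := operator fun σ n => n ∈ σ

def gapOpr : Set ℕ := operator fun σ n => n ∉ σ ∧ ∃ a ∈ σ, n < a

def graphOpr : Set ℕ := operator fun σ n => ∃ i < σ.length, n = cp i (ofList σ i)

def nongraphOpr : Set ℕ :=
  operator fun σ n => n < σ.length ∧ ¬ ∃ i < σ.length, n = cp i (ofList σ i)

def beatsOpr : Set ℕ :=
  operator fun σ n => n < σ.length ∧ ∃ x y, n = cp x y ∧ Beats (ofList σ) x y

def nonbeatsOpr : Set ℕ :=
  operator fun σ n => n < σ.length ∧ ¬ ∃ x y, n = cp x y ∧ Beats (ofList σ) x y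

def listsOpr : Set ℕ := operator fun σ n => ∃ i < σ.length, Lists (ofList σ) i n

theorem out_rangeOpr (f : ℕ → ℕ) : out rangeOpr f = Set.range f := by
  rw [rangeOpr, out_operator]
  ext n
  simp only [mem_res, Set.mem_ofPred_eq, Set.mem_range]
  exact ⟨fun ⟨_, i, _, h⟩ => ⟨i, h⟩, fun ⟨i, h⟩ => ⟨i + 1, i, Nat.lt_succ_self i, h⟩⟩

/-- An increasing function that has passed `n` without taking it as a value never will; this makes
the range decidable, not just enumerable. -/
theorem out_gapOpr {f : ℕ → ℕ} (hf : StrictMono f) : out gapOpr f = (Set.range f)ᶜ := by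
  rw [gapOpr, out_operator]
  ext n
  simp only [mem_res, Set.mem_ofPred_eq, Set.mem_range, Set.mem_compl_iff]
  constructor
  · rintro ⟨k, h, _, ⟨j, hj, rfl⟩, hn⟩ ⟨i, rfl⟩
    exact h ⟨i, (hf.lt_iff_lt.1 hn).trans hj, rfl⟩
  · intro h
    -- Among the first `n + 2` values is `f (n + 1)`, which is at least `n + 1`.
    exact ⟨n + 2, fun ⟨i, _, hi⟩ => h ⟨i, hi⟩, _, ⟨n + 1, Nat.lt_succ_self _, rfl⟩,
      (Nat.lt_succ_self n).trans_le hf.le_apply⟩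

theorem out_graphOpr (f : ℕ → ℕ) : out graphOpr f = {n | ∃ i, n = cp i (f i)} := by
  rw [graphOpr, out_operator]
  ext n
  simp only [length_res, Set.mem_ofPred_eq]
  constructor
  · rintro ⟨k, i, hi, h⟩
    exact ⟨i, by rwa [ofList_res hi] at h⟩
  · rintro ⟨i, h⟩
    exact ⟨i + 1, i, Nat.lt_succ_self i, by rwa [ofList_res (Nat.lt_succ_self i)]⟩

/-- Only an argument `i ≤ n` can have `cp i (f i) = n`, so the first `n + 1` values settle
membership. -/
theorem out_nongraphOpr (f : ℕ → ℕ) : out nongraphOpr f = {n | ∃ i, n = cp i (f i)}ᶜ := by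
  rw [nongraphOpr, out_operator]
  ext n
  simp only [length_res, Set.mem_ofPred_eq, Set.mem_compl_iff]
  constructor
  · rintro ⟨k, hk, h⟩ ⟨i, hi⟩
    have hik : i < k := (hi ▸ left_le_cp i (f i)).trans_lt hk
    exact h ⟨i, hik, by rwa [ofList_res hik]⟩
  · intro h
    refine ⟨n + 1, Nat.lt_succ_self n, ?_⟩
    rintro ⟨i, hi, hn⟩
    exact h ⟨i, by rwa [ofList_res hi] at hn⟩

/-- The tournament coded by `f`, as a set of coded pairs. -/
def tour (f : ℕ → ℕ) : Set ℕ := {n | ∃ x y, n = cp x y ∧ Beats f x y}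

theorem mem_tour {f : ℕ → ℕ} {x y : ℕ} : cp x y ∈ tour f ↔ Beats f x y := by
  refine ⟨?_, fun h => ⟨x, y, rfl, h⟩⟩
  rintro ⟨x', y', h, hb⟩
  rw [cp_inj] at h
  rwa [h.1, h.2]

theorem mem_tour_ofList_res {f : ℕ → ℕ} {k n : ℕ} (h : n < k) :
    n ∈ tour (ofList (res f k)) ↔ n ∈ tour f := by
  have hc : ∀ i < k, ofList (res f k) i = f i := fun i hi => ofList_res hi
  refine exists₂_congr fun x y => and_congr_right ?_
  rintro rfl
  exact Beats.congr hc ((left_le_cp x y).trans_lt h) ((right_le_cp x y).trans_lt h)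

theorem out_beatsOpr (f : ℕ → ℕ) : out beatsOpr f = tour f := by
  rw [beatsOpr, out_operator]
  ext n
  simp only [length_res, Set.mem_ofPred_eq]
  exact ⟨fun ⟨k, hk, h⟩ => (mem_tour_ofList_res hk).1 h, fun h =>
    ⟨n + 1, Nat.lt_succ_self n, (mem_tour_ofList_res (Nat.lt_succ_self n)).2 h⟩⟩

theorem out_nonbeatsOpr (f : ℕ → ℕ) : out nonbeatsOpr f = (tour f)ᶜ := by
  rw [nonbeatsOpr, out_operator]
  ext n
  simp only [length_res, Set.mem_ofPred_eq]
  exact ⟨fun ⟨k, hk, h⟩ h' => h ((mem_tour_ofList_res hk).2 h'), fun h =>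
    ⟨n + 1, Nat.lt_succ_self n, fun h' => h ((mem_tour_ofList_res (Nat.lt_succ_self n)).1 h')⟩⟩

theorem out_listsOpr (f : ℕ → ℕ) : out listsOpr f = {n | ∃ i, Lists f i n} := by
  rw [listsOpr, out_operator]
  ext n
  simp only [length_res, Set.mem_ofPred_eq, Lists]
  constructor
  · rintro ⟨k, i, hi, h⟩
    exact ⟨i, by rwa [ofList_res hi] at h⟩
  · rintro ⟨i, h⟩
    exact ⟨i + 1, i, Nat.lt_succ_self i, by rwa [ofList_res (Nat.lt_succ_self i)]⟩

/-- Finds, for each `e`, the finite subsets with exactly `2 * e + 2` elements. -/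
def subsetsOp : Op := fun S =>
  {n | (finOf n.unpair.2).card = 2 * n.unpair.1 + 2 ∧ ∀ x ∈ finOf n.unpair.2, x ∈ S 0}

def increasingPairs : Set ℕ := {n | n.unpair.1 < n.unpair.2}

/-- All the operations under which the classes of the construction are closed. -/
def ops : Set Op :=
  forcingOps ∪ logicOps ∪ constOp '' {rangeOpr, gapOpr, graphOpr, nongraphOpr, beatsOpr,
    nonbeatsOpr, listsOpr} ∪ {preOp Set.univ (fun m => m.unpair.2),
    preOp increasingPairs (fun n => cp n.unpair.1 n.unpair.2),
    preOp increasingPairs (fun n => cp n.unpair.2 n.unpair.1), subsetsOp}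

theorem ops_countable : ops.Countable :=
  ((forcingOps_countable.union logicOps_countable).union
    ((Set.toFinite _).countable.image _)).union (Set.toFinite _).countable

theorem ops_cont : ∀ Ψ ∈ ops, Ψ.Cont := by
  rintro Ψ (((h | h) | ⟨K, -, rfl⟩) | (rfl | rfl | rfl | rfl))
  · exact forcingOps_cont Ψ h
  · exact logicOps_cont Ψ h
  · exact constOp_cont K
  · exact preOp_cont _ _
  · exact preOp_cont _ _
  · exact preOp_cont _ _
  · exact fun n => (SC.const _).and
      (SC.ball_finset _ fun x => SC.mem (0 : Fin 4) x)

theorem forcingOps_subset : forcingOps ⊆ ops := fun _ h => Or.inl (Or.inl (Or.inl h))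

theorem logicOps_subset : logicOps ⊆ ops := fun _ h => Or.inl (Or.inl (Or.inr h))

theorem lift_mem_ops : preOp Set.univ (fun m => m.unpair.2) ∈ ops := by simp [ops]

theorem dec_mono {𝒮 𝒮' : Set (Set ℕ)} (h : 𝒮 ⊆ 𝒮') : dec 𝒮 ⊆ dec 𝒮' :=
  fun _ hY => ⟨h hY.1, h hY.2⟩

/-- The classes of the construction. -/
structure Stage (d : Set ℕ) (𝒮 : Set (Set ℕ)) : Prop where
  closed : Closed ops 𝒮
  countable : 𝒮.Countable
  mem : d ∈ 𝒮
  fair : Fair d 𝒮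

theorem Stage.iUnion {d : Set ℕ} {𝒮 : ℕ → Set (Set ℕ)} (h : ∀ k, Stage d (𝒮 k))
    (hm : Monotone 𝒮) : Stage d (⋃ k, 𝒮 k) :=
  ⟨Closed.iUnion (fun k => (h k).closed) hm, Set.countable_iUnion fun k => (h k).countable,
    Set.mem_iUnion.2 ⟨0, (h 0).mem⟩, Fair.iUnion fun k => (h k).fair⟩

theorem dec_iUnion {𝒮 : ℕ → Set (Set ℕ)} (hm : Monotone 𝒮) {Y : Set ℕ}
    (hY : Y ∈ dec (⋃ k, 𝒮 k)) : ∃ k, Y ∈ dec (𝒮 k) := by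
  obtain ⟨i, hi⟩ := Set.mem_iUnion.1 hY.1
  obtain ⟨j, hj⟩ := Set.mem_iUnion.1 hY.2
  exact ⟨max i j, hm (le_max_left i j) hi, hm (le_max_right i j) hj⟩

theorem exists_stage : ∃ (f : ℕ → ℕ) (𝒮 : Set (Set ℕ)), (∀ n, Good f n) ∧ tour f ∈ dec 𝒮 ∧
    Stage {n | ∃ i, Lists f i n} 𝒮 := by
  obtain ⟨𝒮, hc, h⟩ := exists_closed ops_countable
  obtain ⟨f, hf, hfair⟩ := exists_fair_tournament hc ⟨_, h.empty⟩
  refine ⟨f, adjoin 𝒮 f, hf,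
    ⟨⟨beatsOpr, h.const (by simp [ops]), out_beatsOpr f⟩,
      ⟨nonbeatsOpr, h.const (by simp [ops]), out_nonbeatsOpr f⟩⟩,
    h.adjoin ops_cont f, hc.image _, ⟨listsOpr, h.const (by simp [ops]), out_listsOpr f⟩, hfair⟩

/-- No infinite transitive subset of the tournament is decidable. -/
theorem Stage.not_transitive {f : ℕ → ℕ} (hf : ∀ n, Good f n) {𝒮 : Set (Set ℕ)}
    (h : Stage {n | ∃ i, Lists f i n} 𝒮) {H : Set ℕ} (hH : H ∈ 𝒮) (hinf : H.Infinite)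
    (htrans : ∀ x ∈ H, ∀ y ∈ H, ∀ z ∈ H, Beats f x y → Beats f y z → Beats f x z) : False := by
  have hA := h.closed.base (Ψ := subsetsOp) (by simp [ops]) hH hH hH hH
  obtain ⟨n, ⟨hcard, hsub⟩, i, hi⟩ := h.fair _ hA fun e => by
    obtain ⟨t, ht, hc⟩ := hinf.exists_subset_card_eq (2 * e + 2)
    refine ⟨finCode t, ?_⟩
    simp only [subsetsOp, Set.mem_ofPred_eq, Nat.unpair_pair, finOf_finCode]
    exact ⟨hc, fun x hx => ht hx⟩
  obtain ⟨N, hN⟩ := (finOf n.unpair.2).finite_toSet.bddAbove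
  -- Beyond `i` so that the finite set is already listed, and beyond `N` so that `z` lies above all
  -- its elements.
  obtain ⟨z, hz, hzN⟩ := hinf.exists_gt (max i N)
  obtain ⟨x, hx, y, hy, h₁, h₂, h₃⟩ := (hf (z + 1)).cycle z (Nat.lt_succ_self z) i
    ((le_max_left _ _).trans_lt hzN) n.unpair.1 n.unpair.2 (by rwa [Nat.pair_unpair]) hcard.ge
    fun x hx => (hN hx).trans_lt ((le_max_right _ _).trans_lt hzN)
  exact (htrans x (hsub x hx) y (hsub y hy) z hz h₁ h₂).asymm h₃

/-- Solving a transitive relation contained in `<`. -/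
theorem Stage.homogeneous {d : Set ℕ} {𝒮 : Set (Set ℕ)} (h : Stage d 𝒮) {R : ℕ → ℕ → Prop}
    (htrans : ∀ a b c, R a b → R b c → R a c)
    (hR : {n : ℕ | n.unpair.1 < n.unpair.2 ∧ R n.unpair.1 n.unpair.2} ∈ 𝒮)
    (hR' : {n : ℕ | n.unpair.1 < n.unpair.2 ∧ ¬ R n.unpair.1 n.unpair.2} ∈ 𝒮)
    {D : Set ℕ} (hD : D ∈ 𝒮) (hinf : D.Infinite) :
    ∃ (𝒮' : Set (Set ℕ)) (g : ℕ → ℕ), 𝒮 ⊆ 𝒮' ∧ Stage d 𝒮' ∧ StrictMono g ∧ (∀ i, g i ∈ D) ∧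
      Set.range g ∈ dec 𝒮' ∧ {n | ∃ i, n = cp i (g i)} ∈ dec 𝒮' ∧
      ((∀ i j, i < j → R (g i) (g j)) ∨ ∀ i j, i < j → ¬ R (g i) (g j)) := by
  obtain ⟨g, hg, hgD, hfair, hhom⟩ := exists_fair_homogeneous forcingOps_subset h.closed
    h.countable h.mem h.fair htrans hR hR' hD hinf
  have hsub := subset_adjoin h.closed lift_mem_ops g
  exact ⟨adjoin 𝒮 g, g, hsub,
    ⟨h.closed.adjoin ops_cont g, h.countable.image _, hsub h.mem, hfair⟩, hg, hgD,
    ⟨⟨rangeOpr, h.closed.const (by simp [ops]), out_rangeOpr g⟩,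
      ⟨gapOpr, h.closed.const (by simp [ops]), out_gapOpr hg⟩⟩,
    ⟨⟨graphOpr, h.closed.const (by simp [ops]), out_graphOpr g⟩,
      ⟨nongraphOpr, h.closed.const (by simp [ops]), out_nongraphOpr g⟩⟩, hhom⟩

/-- The relation coded by `P` has an infinite chain or antichain in `dec 𝒮`, if it is transitive. -/
def SolvesCAC (P : Set ℕ) (𝒮 : Set (Set ℕ)) : Prop :=
  (∀ x y z, cp x y ∈ P → cp y z ∈ P → cp x z ∈ P) →
    ∃ H ∈ dec 𝒮, H.Infinite ∧ ((∀ x ∈ H, ∀ y ∈ H, x ≠ y → cp x y ∈ P ∨ cp y x ∈ P) ∨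
      ∀ x ∈ H, ∀ y ∈ H, x ≠ y → cp x y ∉ P ∧ cp y x ∉ P)

/-- The relation coded by `L`, if it is transitive, has an ascending sequence in `dec 𝒮`, or a
sequence none of whose elements is below a later one. -/
def SolvesADS (L : Set ℕ) (𝒮 : Set (Set ℕ)) : Prop :=
  (∀ x y z, cp x y ∈ L → cp y z ∈ L → cp x z ∈ L) →
    ∃ g : ℕ → ℕ, {n | ∃ i, n = cp i (g i)} ∈ dec 𝒮 ∧ StrictMono g ∧
      ((∀ i j, i < j → cp (g i) (g j) ∈ L) ∨ ∀ i j, i < j → cp (g i) (g j) ∉ L)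

theorem SolvesCAC.mono {P : Set ℕ} {𝒮 𝒮' : Set (Set ℕ)} (hs : 𝒮 ⊆ 𝒮') (h : SolvesCAC P 𝒮) :
    SolvesCAC P 𝒮' := fun ht => by
  obtain ⟨H, hH, h⟩ := h ht
  exact ⟨H, dec_mono hs hH, h⟩

theorem SolvesADS.mono {P : Set ℕ} {𝒮 𝒮' : Set (Set ℕ)} (hs : 𝒮 ⊆ 𝒮') (h : SolvesADS P 𝒮) :
    SolvesADS P 𝒮' := fun ht => by
  obtain ⟨g, hg, h⟩ := h ht
  exact ⟨g, dec_mono hs hg, h⟩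

section solve
variable {d : Set ℕ} {𝒮 : Set (Set ℕ)} (h : Stage d 𝒮) {P : Set ℕ} (hP : P ∈ dec 𝒮)
  (ht : ∀ x y z, cp x y ∈ P → cp y z ∈ P → cp x z ∈ P)
include h hP ht

theorem Stage.exists_upward {D : Set ℕ} (hD : D ∈ 𝒮) (hinf : D.Infinite) :
    ∃ (𝒮' : Set (Set ℕ)) (g : ℕ → ℕ), 𝒮 ⊆ 𝒮' ∧ Stage d 𝒮' ∧ StrictMono g ∧ (∀ i, g i ∈ D) ∧
      Set.range g ∈ dec 𝒮' ∧ {n | ∃ i, n = cp i (g i)} ∈ dec 𝒮' ∧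
      ((∀ i j, i < j → cp (g i) (g j) ∈ P) ∨ ∀ i j, i < j → cp (g i) (g j) ∉ P) :=
  have hop : preOp increasingPairs (fun n => cp n.unpair.1 n.unpair.2) ∈ ops := by simp [ops]
  h.homogeneous (R := fun x y => cp x y ∈ P) ht (h.closed.pre hop hP.1) (h.closed.pre hop hP.2)
    hD hinf

theorem Stage.exists_downward {D : Set ℕ} (hD : D ∈ 𝒮) (hinf : D.Infinite) :
    ∃ (𝒮' : Set (Set ℕ)) (g : ℕ → ℕ), 𝒮 ⊆ 𝒮' ∧ Stage d 𝒮' ∧ StrictMono g ∧ (∀ i, g i ∈ D) ∧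
      Set.range g ∈ dec 𝒮' ∧ {n | ∃ i, n = cp i (g i)} ∈ dec 𝒮' ∧
      ((∀ i j, i < j → cp (g j) (g i) ∈ P) ∨ ∀ i j, i < j → cp (g j) (g i) ∉ P) :=
  have hop : preOp increasingPairs (fun n => cp n.unpair.2 n.unpair.1) ∈ ops := by simp [ops]
  h.homogeneous (R := fun x y => cp y x ∈ P) (fun a b c hab hbc => ht c b a hbc hab)
    (h.closed.pre hop hP.1) (h.closed.pre hop hP.2) hD hinf

end solve

/-- Homogeneity of the range of a strictly increasing sequence. -/
theorem range_pairs {g : ℕ → ℕ} {p : ℕ → ℕ → Prop} (hs : ∀ x y, p x y → p y x)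
    (hp : ∀ i j, i < j → p (g i) (g j)) :
    ∀ x ∈ Set.range g, ∀ y ∈ Set.range g, x ≠ y → p x y := by
  rintro _ ⟨i, rfl⟩ _ ⟨j, rfl⟩ hij
  rcases lt_trichotomy i j with h | rfl | h
  · exact hp i j h
  · exact absurd rfl hij
  · exact hs _ _ (hp j i h)

theorem Stage.exists_solvesCAC {d : Set ℕ} {𝒮 : Set (Set ℕ)} (h : Stage d 𝒮) {P : Set ℕ}
    (hP : P ∈ dec 𝒮) : ∃ 𝒮', 𝒮 ⊆ 𝒮' ∧ Stage d 𝒮' ∧ SolvesCAC P 𝒮' := by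
  -- Without transitivity there is nothing to solve.
  by_cases ht : ∀ x y z, cp x y ∈ P → cp y z ∈ P → cp x z ∈ P
  swap
  · exact ⟨𝒮, subset_rfl, h, fun ht' => absurd ht' ht⟩
  have huniv : Set.univ ∈ 𝒮 := by
    have := h.closed.base (Ψ := unionOp) (logicOps_subset (by simp [logicOps])) hP.1 hP.2 hP.1 hP.1
    convert this using 1
    ext n; simp [unionOp, em]
  obtain ⟨𝒮₁, g₁, hs₁, h₁, hg₁, -, hr₁, -, hu | hu⟩ :=
    h.exists_upward hP ht huniv Set.infinite_univ
  · exact ⟨𝒮₁, hs₁, h₁, fun _ => ⟨_, hr₁, Set.infinite_range_of_injective hg₁.injective,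
      Or.inl (range_pairs (fun _ _ => Or.symm) fun i j hij => Or.inl (hu i j hij))⟩⟩
  -- No element of the range of `g₁` is below a numerically larger one. The reverse direction is
  -- settled inside that range, which is why `homogeneous` allows a domain `D`.
  obtain ⟨𝒮₂, g₂, hs₂, h₂, hg₂, hgr, hr₂, -, hl | hl⟩ := h₁.exists_downward (dec_mono hs₁ hP) ht
    hr₁.1 (Set.infinite_range_of_injective hg₁.injective)
  · exact ⟨𝒮₂, hs₁.trans hs₂, h₂, fun _ => ⟨_, hr₂, Set.infinite_range_of_injective hg₂.injective,
      Or.inl (range_pairs (fun _ _ => Or.symm) fun i j hij => Or.inr (hl i j hij))⟩⟩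
  · refine ⟨𝒮₂, hs₁.trans hs₂, h₂, fun _ => ⟨_, hr₂,
      Set.infinite_range_of_injective hg₂.injective,
      Or.inr (range_pairs (fun _ _ => And.symm) fun i j hij => ⟨?_, hl i j hij⟩)⟩⟩
    obtain ⟨a, ha⟩ := hgr i
    obtain ⟨b, hb⟩ := hgr j
    rw [← ha, ← hb]
    -- Points of the second sequence are values of `g₁`, and their numerical order is the order of
    -- their `g₁`-indices.
    exact hu a b (hg₁.lt_iff_lt.1 (by rw [ha, hb]; exact hg₂ hij))

theorem Stage.exists_solvesADS {d : Set ℕ} {𝒮 : Set (Set ℕ)} (h : Stage d 𝒮) {L : Set ℕ}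
    (hL : L ∈ dec 𝒮) : ∃ 𝒮', 𝒮 ⊆ 𝒮' ∧ Stage d 𝒮' ∧ SolvesADS L 𝒮' := by
  by_cases ht : ∀ x y z, cp x y ∈ L → cp y z ∈ L → cp x z ∈ L
  swap
  · exact ⟨𝒮, subset_rfl, h, fun ht' => absurd ht' ht⟩
  have huniv : Set.univ ∈ 𝒮 := by
    have := h.closed.base (Ψ := unionOp) (logicOps_subset (by simp [logicOps])) hL.1 hL.2 hL.1 hL.1
    convert this using 1
    ext n; simp [unionOp, em]
  obtain ⟨𝒮', g, hs, h', hg, -, -, hgr, hu⟩ := h.exists_upward hL ht huniv Set.infinite_univ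
  exact ⟨𝒮', hs, h', fun _ => ⟨g, hgr, hg, hu⟩⟩

/-- Iterating a one-instance extension property over all the instances in a stage. -/
theorem Stage.exists_solves_all {d : Set ℕ} {Solves : Set ℕ → Set (Set ℕ) → Prop}
    (hmono : ∀ P 𝒮 𝒮', 𝒮 ⊆ 𝒮' → Solves P 𝒮 → Solves P 𝒮')
    (hstep : ∀ 𝒮, Stage d 𝒮 → ∀ P ∈ dec 𝒮, ∃ 𝒮', 𝒮 ⊆ 𝒮' ∧ Stage d 𝒮' ∧ Solves P 𝒮')
    {𝒮 : Set (Set ℕ)} (h : Stage d 𝒮) :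
    ∃ 𝒮', 𝒮 ⊆ 𝒮' ∧ Stage d 𝒮' ∧ ∀ P ∈ dec 𝒮, Solves P 𝒮' := by
  rcases (dec 𝒮).eq_empty_or_nonempty with he | hne
  · exact ⟨𝒮, subset_rfl, h, by simp [he]⟩
  obtain ⟨P, hP⟩ := (h.countable.mono fun Y hY => hY.1 : (dec 𝒮).Countable).exists_eq_range hne
  have hstep' : ∀ (𝒯 : {𝒯 // 𝒮 ⊆ 𝒯 ∧ Stage d 𝒯}) (k : ℕ), ∃ 𝒯' : {𝒯 // 𝒮 ⊆ 𝒯 ∧ Stage d 𝒯},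
      𝒯.1 ⊆ 𝒯'.1 ∧ Solves (P k) 𝒯'.1 := fun 𝒯 k => by
    have hk : P k ∈ dec 𝒮 := hP ▸ ⟨k, rfl⟩
    obtain ⟨𝒯', hs, h', hsol⟩ := hstep 𝒯.1 𝒯.2.2 (P k) (dec_mono 𝒯.2.1 hk)
    exact ⟨⟨𝒯', 𝒯.2.1.trans hs, h'⟩, hs, hsol⟩
  choose next hnext hsol using hstep'
  let T : ℕ → {𝒯 // 𝒮 ⊆ 𝒯 ∧ Stage d 𝒯} := fun k =>
    Nat.rec ⟨𝒮, subset_rfl, h⟩ (fun k 𝒯 => next 𝒯 k) k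
  have hm : Monotone fun k => (T k).1 := monotone_nat_of_le_succ fun k => hnext _ _
  refine ⟨⋃ k, (T k).1, Set.subset_iUnion (fun k => (T k).1) 0,
    Stage.iUnion (fun k => (T k).2.2) hm, fun Y hY => ?_⟩
  obtain ⟨k, rfl⟩ : ∃ k, P k = Y := by rwa [hP] at hY
  exact hmono _ _ _ (Set.subset_iUnion (fun k => (T k).1) (k + 1)) (hsol _ _)

/-- Each round solves the instances present at its start. An instance in the union is decidable at
some finite round, since its two enumerations appear at finite rounds, and is solved in the next
one. -/
theorem Stage.exists_solved {d : Set ℕ} {Solves : Set ℕ → Set (Set ℕ) → Prop}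
    (hmono : ∀ P 𝒮 𝒮', 𝒮 ⊆ 𝒮' → Solves P 𝒮 → Solves P 𝒮')
    (hstep : ∀ 𝒮, Stage d 𝒮 → ∀ P ∈ dec 𝒮, ∃ 𝒮', 𝒮 ⊆ 𝒮' ∧ Stage d 𝒮' ∧ Solves P 𝒮')
    {𝒮 : Set (Set ℕ)} (h : Stage d 𝒮) :
    ∃ 𝒮', 𝒮 ⊆ 𝒮' ∧ Stage d 𝒮' ∧ ∀ P ∈ dec 𝒮', Solves P 𝒮' := by
  have hnext := fun 𝒯 : {𝒯 // Stage d 𝒯} => 𝒯.2.exists_solves_all hmono hstep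
  choose next hsub hstage hsol using hnext
  let T : ℕ → {𝒯 // Stage d 𝒯} := fun k => Nat.rec ⟨𝒮, h⟩ (fun _ 𝒯 => ⟨next 𝒯, hstage 𝒯⟩) k
  have hm : Monotone fun k => (T k).1 := monotone_nat_of_le_succ fun k => hsub _
  refine ⟨⋃ k, (T k).1, Set.subset_iUnion (fun k => (T k).1) 0,
    Stage.iUnion (fun k => (T k).2) hm, fun Y hY => ?_⟩
  obtain ⟨k, hk⟩ := dec_iUnion hm hY
  exact hmono _ _ _ (Set.subset_iUnion (fun k => (T k).1) (k + 1)) (hsol _ _ hk)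

/-! ### Truth of `CAC` and `ADS`, and failure of `EM`, in the models. -/

theorem valid_CAC {𝒮 : Set (Set ℕ)} (h : ∀ P ∈ dec 𝒮, SolvesCAC P 𝒮) : Valid (dec 𝒮) CAC := by
  intro e s _
  simp only [CAC, partialOrder, SOA.infinite, chain, antichain, inn, rel, eqv, ltv, Tm.pair, Sat,
    sat_and, sat_or, sat_ex, sat_exS, Tm.val, update_apply]
  simp only [reduceIte, OfNat.ofNat_ne_zero, OfNat.zero_ne_ofNat, zero_ne_one, one_ne_zero,
    OfNat.ofNat_ne_one, OfNat.one_ne_ofNat]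
  rintro P hP ⟨hrefl, -, htrans⟩
  obtain ⟨H, hH, hinf, hhom⟩ := h P hP fun x y z hxy hyz => htrans x y z ⟨hxy, hyz⟩
  refine ⟨H, hH, fun x => ?_, hhom.imp (fun hc x y hxy => ?_) fun ha x y hxy => ?_⟩
  · obtain ⟨y, hy, hxy⟩ := hinf.exists_gt x
    exact ⟨y, hxy, hy⟩
  · rcases eq_or_ne x y with rfl | hne
    · exact Or.inl (hrefl x)
    · exact hc x hxy.1 y hxy.2 hne
  · exact ha x hxy.1 y hxy.2.1 hxy.2.2

theorem valid_ADS {𝒮 : Set (Set ℕ)} (h : ∀ L ∈ dec 𝒮, SolvesADS L 𝒮) : Valid (dec 𝒮) ADS := by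
  intro e s _
  simp only [ADS, linearOrder, SOA.function, ascending, descending, rel, eqv, ltv, Tm.pair, Sat,
    sat_and, sat_or, sat_ex, sat_exS, Tm.val, update_apply]
  simp only [reduceIte, OfNat.ofNat_ne_zero, OfNat.zero_ne_ofNat, zero_ne_one, one_ne_zero,
    OfNat.ofNat_ne_one, OfNat.one_ne_ofNat, Nat.reduceEqDiff]
  rintro L hL ⟨-, htrans, htot⟩
  obtain ⟨g, hgr, hg, hhom⟩ := h L hL fun x y z hxy hyz => htrans x y z ⟨hxy, hyz⟩
  have hmem : ∀ {i a : ℕ}, cp i a ∈ {n | ∃ i, n = cp i (g i)} → a = g i := fun {i a} ⟨j, hj⟩ => by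
    rw [cp_inj] at hj
    rw [hj.2, hj.1]
  refine ⟨_, hgr, ⟨fun i => ⟨g i, i, rfl⟩, fun i a b hab => (hmem hab.1).trans (hmem hab.2).symm⟩,
    hhom.imp (fun ha i j a b hab => ?_) fun hd i j a b hab => ?_⟩
  · rw [hmem hab.2.1, hmem hab.2.2]
    exact ha i j hab.1
  · rw [hmem hab.2.1, hmem hab.2.2]
    -- In a linear order, distinct elements that are not ascending descend; distinctness comes from
    -- `g` being strictly increasing.
    rcases htot (g i) (g j) with h' | h' | h'
    · exact absurd h' (hd i j hab.1)
    · exact absurd h' (hg hab.1).ne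
    · exact h'

theorem Stage.not_valid_EM {f : ℕ → ℕ} (hf : ∀ n, Good f n) {𝒮 : Set (Set ℕ)}
    (h : Stage {n | ∃ i, Lists f i n} 𝒮) (hT : tour f ∈ dec 𝒮) : ¬ Valid (dec 𝒮) EM := by
  intro hv
  have := hv 0 (fun _ => tour f) fun _ => hT
  simp only [EM, tournament, SOA.infinite, transitiveOn, inn, rel, eqv, ltv, Tm.pair, Sat,
    sat_and, sat_iff, sat_ex, sat_exS, Tm.val, update_apply] at this
  simp only [reduceIte, OfNat.ofNat_ne_zero, OfNat.zero_ne_ofNat, zero_ne_one, one_ne_zero,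
    OfNat.ofNat_ne_one, OfNat.one_ne_ofNat] at this
  obtain ⟨H, hH, hinf, htrans⟩ := this (tour f) hT
    ⟨fun x hx => (mem_tour.1 hx).asymm (mem_tour.1 hx), fun x y hxy => by
      change cp x y ∈ tour f ↔ cp y x ∉ tour f
      rw [mem_tour, mem_tour]
      exact ⟨Beats.asymm, fun hn => (Beats.total f hxy).resolve_right hn⟩⟩
  refine h.not_transitive hf hH.1 (Set.infinite_of_forall_exists_gt fun x => ?_)
    fun x hx y hy z hz hxy hyz =>
      mem_tour.1 (htrans x y z ⟨hx, hy, hz⟩ ⟨mem_tour.2 hxy, mem_tour.2 hyz⟩)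
  obtain ⟨y, hxy, hy⟩ := hinf x
  exact ⟨y, hy, hxy⟩

theorem Stage.not_proves {f : ℕ → ℕ} (hf : ∀ n, Good f n) {𝒮 : Set (Set ℕ)}
    (h : Stage {n | ∃ i, Lists f i n} 𝒮) (hT : tour f ∈ dec 𝒮) {φ : Fm}
    (hφ : Valid (dec 𝒮) φ) : ¬ Proves φ EM := fun hp => by
  refine h.not_valid_EM hf hT (Derives.valid hp ?_)
  rintro ψ (hψ | rfl)
  · exact h.closed.valid_RCA0 logicOps_subset hψ
  · exact hφ

end SOA

theorem corollary1p5 :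
    ¬ SOA.Proves SOA.CAC SOA.EM ∧ ¬ SOA.Proves SOA.ADS SOA.EM := by
  obtain ⟨f, 𝒮, hf, hT, h⟩ := SOA.exists_stage
  refine ⟨?_, ?_⟩
  · obtain ⟨𝒮', hs, h', hsol⟩ := SOA.Stage.exists_solved (Solves := SOA.SolvesCAC)
      (fun _ _ _ => SOA.SolvesCAC.mono) (fun _ h _ hP => h.exists_solvesCAC hP) h
    exact h'.not_proves hf (SOA.dec_mono hs hT) (SOA.valid_CAC hsol)
  · obtain ⟨𝒮', hs, h', hsol⟩ := SOA.Stage.exists_solved (Solves := SOA.SolvesADS)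
      (fun _ _ _ => SOA.SolvesADS.mono) (fun _ h _ hP => h.exists_solvesADS hP) h
    exact h'.not_proves hf (SOA.dec_mono hs hT) (SOA.valid_ADS hsol)
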